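/- Let $c_0>0$, $\gamma\ge 0$, $\omega\in\mathbb{R}$ and $0\le\kappa<1/c_0$, put $c_0(\kappa)=c_0/\sqrt{1-\kappa^2c_0^2}$ and $r=\dfrac{\gamma\, c_0(\kappa)^2\omega^2}{4c_0^4}$. Let $(N_{\omega,\kappa}(z))_{0\le z\le L}$ be a jump Markov process with state space $\mathbb{N}=\{0,1,2,\dots\}$, with arbitrary initial distribution, and with infinitesimal generator $$\mathcal{L}\phi(N)=r\big[(N+1)^2(\phi(N+1)-\phi(N))+N^2(\phi(N-1)-\phi(N))\big].$$ For $n\in\mathbb{N}$ define the polynomials $$P_n(u)=\sum_{j=0}^n\binom{n}{j}(-1)^jK_j(u),\qquad K_0(u)=1,\qquad K_n(u)=\prod_{j=1}^n\frac{1}{j^2}\Big[u^2+\big(j-\tfrac12\big)^2\Big].$$ Then: 1. For all $z_0,z\ge 0$ with $z_0+z\le L$ and all $n,p\in\mathbb{N}$, the transition probabilities of $N_{\omega,\kappa}$ are $$\mathbb{P}\big(N_{\omega,\kappa}(z_0+z)=n\,\big|\,N_{\omega,\kappa}(z_0)=p\big)=e^{-\tilde z/4}\int_0^\infty e^{-u^2\tilde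 z}\,P_n(u)P_p(u)\,\frac{2\pi u\sinh(\pi u)}{\cosh^2(\pi u)}\,du,\qquad \tilde z=rz,$$ where the integral converges absolutely. The formula holds both for the transition function of the process, for all $n$ and $p$, and for the elementary conditional probability whenever $\mathbb{P}(N_{\omega,\kappa}(z_0)=p)>0$. 2. The polynomials $(P_n)_{n\ge0}$ are equivalently defined by the recurrence $$P_{n+1}(u)=\frac{2n^2+2n+\frac34-u^2}{(n+1)^2}P_n(u)-\frac{n^2}{(n+1)^2}P_{n-1}(u)\quad(n\ge1),\qquad P_0(u)=1,\quad P_1(u)=\tfrac34-u^2.$$ 3. The polynomials $P_n$ are orthonormal for the weight $\frac{2\pi u\sinh(\pi u)}{\cosh^2(\pi u)}\mathbf 1_{[0,\infty)}(u)$: for all $n,p\in\mathbb{N}$ the following integral converges absolutely and $$\int_0^\infty P_n(u)P_p(u)\,\frac{2\pi u\sinh(\pi u)}{\cosh^2(\pi u)}\,du=\begin{cases}1,&n=p,\\0,&n\ne p.\end{cases}$$ -/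

import Mathlib

open MeasureTheory ProbabilityTheory Set Filter Topology Polynomial

noncomputable section

/-- The mode-dependent velocity `c₀(κ) = c₀ / √(1 - κ² c₀²)`. -/
def modeSpeed (c₀ κ : ℝ) : ℝ := c₀ / Real.sqrt (1 - κ ^ 2 * c₀ ^ 2)

/-- The rate `γ c₀(κ)² ω² / (4 c₀⁴)`. -/
def scatteringRate (c₀ γ ω κ : ℝ) : ℝ :=
  γ * modeSpeed c₀ κ ^ 2 * ω ^ 2 / (4 * c₀ ^ 4)

/-- The operator
`φ ↦ rate * [(N+1)² (φ(N+1) - φ(N)) + N² (φ(N-1) - φ(N))]` on functions on `ℕ`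
(at `N = 0` the second term vanishes because of the factor `N²`). -/
def jumpGenerator (c₀ γ ω κ : ℝ) (φ : ℕ → ℝ) (N : ℕ) : ℝ :=
  scatteringRate c₀ γ ω κ *
    (((N : ℝ) + 1) ^ 2 * (φ (N + 1) - φ N) + (N : ℝ) ^ 2 * (φ (N - 1) - φ N))

/-- A (possibly inhomogeneous) Markov transition family on the state space `ℕ` over the interval
`[0, ℓ]`: `T s t p {n}` is the probability to be in `n` at `t` when one is in `p` at `s`. -/
structure IsTransitionFamily (ℓ : ℝ) (T : ℝ → ℝ → Kernel ℕ ℕ) : Prop where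
  markov : ∀ s t, 0 ≤ s → s ≤ t → t ≤ ℓ → IsMarkovKernel (T s t)
  refl : ∀ s, 0 ≤ s → s ≤ ℓ → T s s = Kernel.id
  chapman_kolmogorov : ∀ s t u, 0 ≤ s → s ≤ t → t ≤ u → u ≤ ℓ → T t u ∘ₖ T s t = T s u

/-- `A` is the infinitesimal generator of the transition family `T` at every point of `[0, ℓ]`:
for every finitely supported `φ` and every state `i`,
`(T_{z,z+h} φ (i) - φ (i)) / h` and `(T_{z-h,z} φ (i) - φ (i)) / h` tend to `A φ (i)` as `h ↓ 0`.
For a homogeneous family, `T_{s,t} = T_{t-s}`, the two limits are the same condition; in the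
inhomogeneous setting the second one excludes jumps at deterministic points. -/
structure HasGenerator (ℓ : ℝ) (T : ℝ → ℝ → Kernel ℕ ℕ) (A : (ℕ → ℝ) → ℕ → ℝ) : Prop where
  right : ∀ φ : ℕ → ℝ, φ.support.Finite → ∀ (i : ℕ) (z : ℝ), 0 ≤ z → z < ℓ →
    Tendsto (fun h : ℝ => ((∫ j, φ j ∂(T z (z + h) i)) - φ i) / h) (𝓝[>] 0) (𝓝 (A φ i))
  left : ∀ φ : ℕ → ℝ, φ.support.Finite → ∀ (i : ℕ) (z : ℝ), 0 < z → z ≤ ℓ →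
    Tendsto (fun h : ℝ => ((∫ j, φ j ∂(T (z - h) z i)) - φ i) / h) (𝓝[>] 0) (𝓝 (A φ i))

/-- The information carried by `N` up to `s`. -/
abbrev pastSigma {Ω : Type*} (N : ℝ → Ω → ℕ) (s : ℝ) : MeasurableSpace Ω :=
  ⨆ u ∈ Icc (0 : ℝ) s, MeasurableSpace.comap (N u) ⊤

/-- `(N z)_{0 ≤ z ≤ ℓ}` is a jump Markov process on `ℕ`, under the probability `P`, with transition
family `T` and infinitesimal generator `A`. Its initial distribution is arbitrary. -/
structure IsJumpMarkovProcess {Ω : Type*} [MeasurableSpace Ω] (P : Measure Ω) (ℓ : ℝ)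
    (N : ℝ → Ω → ℕ) (T : ℝ → ℝ → Kernel ℕ ℕ) (A : (ℕ → ℝ) → ℕ → ℝ) : Prop where
  transition : IsTransitionFamily ℓ T
  generator : HasGenerator ℓ T A
  measurable : ∀ z, 0 ≤ z → z ≤ ℓ → Measurable (N z)
  /-- Almost every path is a right-continuous step function with left limits. -/
  right_continuous : ∀ᵐ x ∂P, ∀ z, 0 ≤ z → z < ℓ → ∀ᶠ y in 𝓝[>] z, N y x = N z x
  left_limits : ∀ᵐ x ∂P, ∀ z, 0 < z → z ≤ ℓ → ∃ n, ∀ᶠ y in 𝓝[<] z, N y x = n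
  /-- Markov property: given the past up to `s`, the law of `N t` is `T s t (N s)`. -/
  markov_property : ∀ s t, 0 ≤ s → s ≤ t → t ≤ ℓ → ∀ n : ℕ,
    P[(N t ⁻¹' {n}).indicator (fun _ => (1 : ℝ)) | pastSigma N s]
      =ᵐ[P] fun x => (T s t (N s x)).real {n}

/-- `K_n(u) = ∏_{j=1}^n (1/j²) [u² + (j - 1/2)²]`. -/
def polyK (n : ℕ) : ℝ[X] :=
  ∏ j ∈ Finset.Icc 1 n, C (1 / (j : ℝ) ^ 2) * (X ^ 2 + C (((j : ℝ) - 1 / 2) ^ 2))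

/-- `P_n(u) = ∑_{j=0}^n (n choose j) (-1)^j K_j(u)`. -/
def polyP (n : ℕ) : ℝ[X] :=
  ∑ j ∈ Finset.range (n + 1), C ((n.choose j : ℝ) * (-1) ^ j) * polyK j

/-- The weight `2 π u sinh(π u) / cosh²(π u)`. -/
def weight (u : ℝ) : ℝ :=
  2 * Real.pi * u * Real.sinh (Real.pi * u) / Real.cosh (Real.pi * u) ^ 2

/-- `e^{-u² ζ} P_n(u) P_p(u) * weight(u)`. -/
def transitionIntegrand (ζ : ℝ) (n p : ℕ) (u : ℝ) : ℝ :=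
  Real.exp (-u ^ 2 * ζ) * ((polyP n).eval u * (polyP p).eval u) * weight u

/-- `e^{-ζ/4} ∫₀^∞ e^{-u² ζ} P_n(u) P_p(u) * weight(u) du`. -/
def transitionFormula (ζ : ℝ) (n p : ℕ) : ℝ :=
  Real.exp (-ζ / 4) * ∫ u in Ioi (0 : ℝ), transitionIntegrand ζ n p u

end

/-!
The polynomials `P_n` are continuous dual Hahn polynomials in `u ^ 2`. Since
`u ^ 2 K_j = (j + 1) ^ 2 K_{j+1} - (j + 1/2) ^ 2 K_j`, the sequence `n ↦ P_n(u)` is an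
eigenfunction, with eigenvalue `-(u ^ 2 + 1/4)`, of the birth-death generator with birth rates
`(n + 1) ^ 2` and death rates `n ^ 2` (`generator_eval_polyP`); this is the three-term recurrence.

*Orthonormality.* Every `K_j` has integral `1` against the weight (`integral_polyK_mul_weight`).
For `j = 0` there is an explicit antiderivative. The difference of the integrands for `j + 1` and
`j` is, up to a constant, the difference of the values on `Im z = -1/2` and `Im z = 1/2` of a
function which is odd and holomorphic in the strip between these lines, so Cauchy's theorem on the
rectangles `[0, R] × [-1/2, 1/2]` applies. By the binomial theorem `∫ P_n w = δ_{n0}`. The rest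
follows from the symmetry of the generator: the Gram matrix satisfies the same equation in its row
index as in its column index, and is determined by this equation and its first column
(`orthonormal_polyP`).

*Transition probabilities.* The spectral formula is bounded by `1` (by orthonormality), is the
identity at time `0`, and solves the backward equation (`hasDerivAt_transitionFormula`). The
transition function has the same three properties: its backward equation (`HasGenerator.backward`)
follows from the Chapman-Kolmogorov equation, because the rows of the generator sum to zero and
hence the mass that leaves `{i - 1, i, i + 1}` in time `h` is `o(h)`. Although the rates are
unbounded, bounded solutions of the backward equation are unique, because `p ↦ p + 1` is a
Lyapunov function: the generator maps it to `r (2 p + 1)` (`nonpos_of_backward_equation`).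
-/

/-! ### Recurrences for the polynomials -/

theorem polyK_succ (j : ℕ) :
    polyK (j + 1) = C (1 / ((j : ℝ) + 1) ^ 2) * (X ^ 2 + C (((j : ℝ) + 1 / 2) ^ 2)) * polyK j := by
  rw [polyK, Finset.prod_Icc_succ_top (by omega), ← polyK, mul_comm]
  push_cast
  congr 5
  ring

theorem eval_polyK_succ (j : ℕ) (u : ℝ) :
    ((j : ℝ) + 1) ^ 2 * (polyK (j + 1)).eval u
      = (u ^ 2 + ((j : ℝ) + 1 / 2) ^ 2) * (polyK j).eval u := by
  have : (j : ℝ) + 1 ≠ 0 := by positivity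
  rw [polyK_succ]
  simp only [eval_mul, eval_add, eval_C, eval_pow, eval_X]
  field_simp

theorem eval_polyP (n : ℕ) (u : ℝ) :
    (polyP n).eval u
      = ∑ j ∈ Finset.range (n + 1), (n.choose j : ℝ) * (-1) ^ j * (polyK j).eval u := by
  simp [polyP, eval_finsetSum]

theorem eval_polyP_of_le {n m : ℕ} (h : n ≤ m) (u : ℝ) :
    (polyP n).eval u
      = ∑ j ∈ Finset.range (m + 1), (n.choose j : ℝ) * (-1) ^ j * (polyK j).eval u := by
  rw [eval_polyP]
  refine Finset.sum_subset (Finset.range_subset_range.2 (by omega)) fun j _ hj => ?_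
  rw [Nat.choose_eq_zero_of_lt (by simpa using hj)]
  simp

theorem choose_recurrence (n j : ℕ) :
    ((n : ℝ) + 1) ^ 2 * ((n + 1).choose (j + 1) : ℝ) + (n : ℝ) ^ 2 * ((n - 1).choose (j + 1) : ℝ)
      = (2 * (n : ℝ) ^ 2 + 2 * n + 1 + ((j : ℝ) + 1) ^ 2 + (j + 1)) * (n.choose (j + 1) : ℝ)
        + ((j : ℝ) + 1) ^ 2 * (n.choose j : ℝ) := by
  have h3 : ((n + 1).choose (j + 1) : ℝ) = n.choose j + n.choose (j + 1) := by
    exact_mod_cast Nat.choose_succ_succ n j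
  have h2 : ((j : ℝ) + 1) * n.choose (j + 1) = ((n : ℝ) - j) * n.choose j := by
    have e1 : ((n : ℝ) + 1) * n.choose j = (n + 1).choose (j + 1) * (j + 1) := by
      exact_mod_cast Nat.add_one_mul_choose_eq n j
    linear_combination -e1 - (j + 1 : ℝ) * h3
  have h1 : (n : ℝ) * ((n - 1).choose (j + 1) : ℝ) = ((n : ℝ) - (j + 1)) * n.choose (j + 1) := by
    rcases n with _ | n
    · simp
    · have e1 : ((n : ℝ) + 1) * n.choose j = (n + 1).choose (j + 1) * (j + 1) := by
        exact_mod_cast Nat.add_one_mul_choose_eq n j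
      have e2 : ((n + 1).choose (j + 1) : ℝ) = n.choose j + n.choose (j + 1) := by
        exact_mod_cast Nat.choose_succ_succ n j
      simp only [Nat.add_sub_cancel]
      push_cast
      linear_combination (-(n : ℝ) - 1) * e2 - e1
  linear_combination ((n : ℝ) + 1) ^ 2 * h3 + n * h1 - (n + j + 2 : ℝ) * h2

/-- `P_n(u)`, as a function of the index `n`, is an eigenfunction of the birth-death generator with
birth rates `(n+1)²` and death rates `n²`, with eigenvalue `-(u² + 1/4)`. -/
theorem generator_eval_polyP (n : ℕ) (u : ℝ) :
    ((n : ℝ) + 1) ^ 2 * ((polyP (n + 1)).eval u - (polyP n).eval u)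
        + (n : ℝ) ^ 2 * ((polyP (n - 1)).eval u - (polyP n).eval u)
      = -(u ^ 2 + 1 / 4) * (polyP n).eval u := by
  have hshift : ∑ j ∈ Finset.range (n + 1 + 1),
        (n.choose j : ℝ) * (-1) ^ j * (((j : ℝ) + 1) ^ 2 * (polyK (j + 1)).eval u)
      = ∑ j ∈ Finset.range (n + 1),
        (n.choose j : ℝ) * (-1) ^ j * (((j : ℝ) + 1) ^ 2 * (polyK (j + 1)).eval u) := by
    rw [Finset.sum_range_succ _ (n + 1), Nat.choose_succ_self]
    simp
  have hK : ∑ j ∈ Finset.range (n + 1 + 1),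
        (n.choose j : ℝ) * (-1) ^ j * (((j : ℝ) + 1) ^ 2 * (polyK (j + 1)).eval u)
      = ∑ j ∈ Finset.range (n + 1 + 1), (n.choose j : ℝ) * (-1) ^ j *
          ((u ^ 2 + ((j : ℝ) + 1 / 2) ^ 2) * (polyK j).eval u) :=
    Finset.sum_congr rfl fun j _ => by rw [eval_polyK_succ]
  rw [eval_polyP_of_le (le_refl (n + 1)), eval_polyP_of_le (show n ≤ n + 1 by omega),
    eval_polyP_of_le (show n - 1 ≤ n + 1 by omega)]
  have hsplit : ∑ j ∈ Finset.range (n + 1 + 1),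
        (((n : ℝ) + 1) ^ 2 * (n + 1).choose j + (n : ℝ) ^ 2 * (n - 1).choose j
          - (2 * (n : ℝ) ^ 2 + 2 * n + 1 + (j : ℝ) ^ 2 + j) * n.choose j)
          * ((-1) ^ j * (polyK j).eval u)
      = -∑ j ∈ Finset.range (n + 1),
        (n.choose j : ℝ) * (-1) ^ j * (((j : ℝ) + 1) ^ 2 * (polyK (j + 1)).eval u) := by
    rw [Finset.sum_range_succ', ← Finset.sum_neg_distrib]
    have h0 : ((n : ℝ) + 1) ^ 2 * (n + 1).choose 0 + (n : ℝ) ^ 2 * (n - 1).choose 0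
        - (2 * (n : ℝ) ^ 2 + 2 * n + 1 + ((0 : ℕ) : ℝ) ^ 2 + (0 : ℕ)) * n.choose 0 = 0 := by
      simp only [Nat.choose_zero_right]
      push_cast
      ring
    rw [h0, zero_mul, add_zero]
    refine Finset.sum_congr rfl fun j _ => ?_
    push_cast
    rw [pow_succ]
    linear_combination (-(-1) ^ j * (polyK (j + 1)).eval u) * choose_recurrence n j
  rw [← hshift, hK, ← sub_eq_zero, sub_neg_eq_add] at hsplit
  rw [← sub_eq_zero]
  refine Eq.trans ?_ hsplit
  simp only [← Finset.sum_sub_distrib, Finset.mul_sum, ← Finset.sum_add_distrib]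
  refine Finset.sum_congr rfl fun j _ => ?_
  ring

theorem polyP_zero : polyP 0 = 1 := by simp [polyP, polyK]

theorem polyP_succ (n : ℕ) :
    polyP (n + 1) =
      C (1 / ((n : ℝ) + 1) ^ 2) *
          (C (2 * (n : ℝ) ^ 2 + 2 * (n : ℝ) + 3 / 4) - X ^ 2) * polyP n
        - C ((n : ℝ) ^ 2 / ((n : ℝ) + 1) ^ 2) * polyP (n - 1) := by
  refine Polynomial.funext fun u => ?_
  have h := generator_eval_polyP n u
  have : (n : ℝ) + 1 ≠ 0 := by positivity
  simp only [eval_mul, eval_sub, eval_C, eval_pow, eval_X]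
  field_simp
  linear_combination 4 * h

theorem polyP_one : polyP 1 = C (3 / 4) - X ^ 2 := by
  have := polyP_succ 0
  simpa [polyP_zero] using this

theorem eq_polyP_iff_recurrence (R : ℕ → ℝ[X]) :
    (∀ n, R n = polyP n) ↔
        (R 0 = 1 ∧ R 1 = C (3 / 4) - X ^ 2 ∧
          ∀ n : ℕ, 1 ≤ n →
            R (n + 1) =
              C (1 / ((n : ℝ) + 1) ^ 2) *
                  (C (2 * (n : ℝ) ^ 2 + 2 * (n : ℝ) + 3 / 4) - X ^ 2) * R n
                - C ((n : ℝ) ^ 2 / ((n : ℝ) + 1) ^ 2) * R (n - 1)) := by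
  constructor
  · intro h
    simp only [h]
    exact ⟨polyP_zero, polyP_one, fun n _ => polyP_succ n⟩
  · rintro ⟨h0, h1, h⟩ n
    induction n using Nat.strong_induction_on with
    | _ n ih =>
      rcases n with _ | _ | n
      · rw [h0, polyP_zero]
      · rw [h1, polyP_one]
      · rw [h (n + 1) (by omega), ih (n + 1) (by omega), ih (n + 1 - 1) (by omega),
          polyP_succ (n + 1)]

/-! ### The weight and its total mass -/

theorem continuous_weight : Continuous weight := by
  unfold weight
  fun_prop (disch := intro x; positivity)

theorem weight_nonneg {u : ℝ} (hu : 0 ≤ u) : 0 ≤ weight u := by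
  have h : 0 ≤ Real.sinh (Real.pi * u) := Real.sinh_nonneg_iff.2 (by positivity)
  unfold weight
  positivity

theorem weight_le {u : ℝ} (hu : 0 ≤ u) :
    weight u ≤ 4 * Real.pi * u * Real.exp (-(Real.pi * u)) := by
  have h1 : Real.sinh (Real.pi * u) ≤ Real.cosh (Real.pi * u) := (Real.sinh_lt_cosh _).le
  have h2 : 0 < Real.cosh (Real.pi * u) := Real.cosh_pos _
  have h3 : 1 ≤ 2 * Real.exp (-(Real.pi * u)) * Real.cosh (Real.pi * u) := by
    rw [Real.cosh_eq]
    have : Real.exp (-(Real.pi * u)) * Real.exp (Real.pi * u) = 1 := by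
      rw [← Real.exp_add]; simp
    nlinarith [Real.exp_pos (-(Real.pi * u))]
  unfold weight
  rw [div_le_iff₀ (by positivity)]
  have h4 : 0 ≤ 2 * Real.pi * u := by positivity
  calc 2 * Real.pi * u * Real.sinh (Real.pi * u)
      ≤ 2 * Real.pi * u * (Real.cosh (Real.pi * u) * 1) := by rw [mul_one]; gcongr
    _ ≤ 2 * Real.pi * u * (Real.cosh (Real.pi * u) *
          (2 * Real.exp (-(Real.pi * u)) * Real.cosh (Real.pi * u))) := by gcongr
    _ = _ := by ring

/-- The weight has moments of all orders. -/
theorem integrableOn_eval_mul_weight (q : ℝ[X]) :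
    IntegrableOn (fun u => q.eval u * weight u) (Ioi 0) := by
  refine integrable_of_isBigO_exp_neg (b := 1) one_pos
    ((q.continuous.mul continuous_weight).continuousOn) ?_
  have h := (Polynomial.tendsto_div_exp_atTop (C (4 * Real.pi) * X * q)).isBigO_one ℝ
  have h2 : (fun u : ℝ => q.eval u * weight u) =O[atTop]
      fun u => ((C (4 * Real.pi) * X * q).eval u / Real.exp u) * Real.exp (-1 * u) := by
    refine Asymptotics.IsBigO.of_bound 1 ?_
    filter_upwards [eventually_ge_atTop 0] with u hu
    have hpi := Real.pi_gt_three
    have h3 : weight u ≤ 4 * Real.pi * u * (Real.exp (-u) * Real.exp (-1 * u)) := by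
      refine (weight_le hu).trans ?_
      rw [← Real.exp_add]
      gcongr
      nlinarith
    simp only [eval_mul, eval_C, eval_X, norm_mul, norm_div, Real.norm_eq_abs, Real.abs_exp,
      abs_of_nonneg (weight_nonneg hu), abs_of_nonneg hu, one_mul]
    rw [Real.exp_neg u] at h3
    calc |q.eval u| * weight u
        ≤ |q.eval u| * (4 * Real.pi * u * ((Real.exp u)⁻¹ * Real.exp (-1 * u))) := by gcongr
      _ = _ := by
        rw [abs_of_pos Real.pi_pos, abs_of_pos (by norm_num : (0 : ℝ) < 4), div_eq_mul_inv]
        ring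
  refine h2.trans ?_
  simpa using h.mul (Asymptotics.isBigO_refl (fun u : ℝ => Real.exp (-1 * u)) atTop)

theorem tendsto_sinh_atTop : Tendsto Real.sinh atTop atTop :=
  Real.sinhOrderIso.tendsto_atTop

theorem integral_weight : ∫ u in Ioi (0 : ℝ), weight u = 1 := by
  have hpi := Real.pi_pos
  have hlim : Tendsto (fun u : ℝ => -(2 * u / Real.cosh (Real.pi * u))
      + 2 / Real.pi * Real.arctan (Real.sinh (Real.pi * u))) atTop
      (𝓝 (-0 + 2 / Real.pi * (Real.pi / 2))) := by
    refine Tendsto.add (Tendsto.neg ?_) (Tendsto.const_mul _ ?_)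
    · have h := Polynomial.tendsto_div_exp_atTop (C 4 * X)
      refine squeeze_zero' ?_ ?_ h
      · filter_upwards [eventually_ge_atTop 0] with u hu
        positivity
      · filter_upwards [eventually_ge_atTop 0] with u hu
        rw [div_le_div_iff₀ (Real.cosh_pos _) (Real.exp_pos _)]
        have h1 : Real.exp u ≤ 2 * Real.cosh (Real.pi * u) := by
          have : Real.exp u ≤ Real.exp (Real.pi * u) :=
            Real.exp_le_exp.2 (by nlinarith [Real.pi_gt_three])
          rw [Real.cosh_eq]
          linarith [Real.exp_pos (-(Real.pi * u))]
        simp only [eval_mul, eval_C, eval_X]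
        nlinarith
    · exact (Real.tendsto_arctan_atTop.mono_right nhdsWithin_le_nhds).comp
        (tendsto_sinh_atTop.comp (tendsto_id.const_mul_atTop hpi))
  have hderiv : ∀ u : ℝ, HasDerivAt (fun u : ℝ => -(2 * u / Real.cosh (Real.pi * u))
      + 2 / Real.pi * Real.arctan (Real.sinh (Real.pi * u))) (weight u) u := by
    intro u
    have hl : HasDerivAt (fun u : ℝ => Real.pi * u) Real.pi u := by
      simpa using (hasDerivAt_id u).const_mul Real.pi
    have h2 : HasDerivAt (fun u : ℝ => 2 * u) 2 u := by
      simpa using (hasDerivAt_id u).const_mul 2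
    have hne := (Real.cosh_pos (Real.pi * u)).ne'
    refine (((h2.div hl.cosh hne).neg).add (hl.sinh.arctan.const_mul (2 / Real.pi))).congr_deriv ?_
    rw [show 1 + Real.sinh (Real.pi * u) ^ 2 = Real.cosh (Real.pi * u) ^ 2 by
      rw [Real.cosh_sq]; ring]
    unfold weight
    field_simp
    ring
  have hint : IntegrableOn weight (Ioi 0) := by
    simpa using integrableOn_eval_mul_weight 1
  have := integral_Ioi_of_hasDerivAt_of_tendsto (hderiv 0).continuousAt.continuousWithinAt
    (fun u _ => hderiv u) hint hlim
  rw [this]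
  simp

/-! ### Contour integration -/

/-- The function whose integral along the boundary of the rectangles `[0, R] × [-1/2, 1/2]` compares
the integrals of two consecutive `K_j`. The numerator vanishes at `0` to a higher order than
`sinh (π z) ^ 2`, so that the value `0 / 0 = 0` at the origin is the continuous extension. -/
noncomputable def contourFun (j : ℕ) (z : ℂ) : ℂ :=
  (z ^ 3 * ∏ k ∈ Finset.Icc 1 j, ((k : ℂ) ^ 2 + z ^ 2)) * Complex.cosh (Real.pi * z)
    / Complex.sinh (Real.pi * z) ^ 2

theorem sinh_pi_mul_ne_zero {z : ℂ} (hz : |z.im| ≤ 1 / 2) (h0 : z ≠ 0) :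
    Complex.sinh (Real.pi * z) ≠ 0 := by
  intro h
  have h1 : Complex.sin (Real.pi * z * Complex.I) = 0 := by rw [Complex.sin_mul_I, h, zero_mul]
  obtain ⟨k, hk⟩ := Complex.sin_eq_zero_iff.1 h1
  have hpi : (Real.pi : ℂ) ≠ 0 := by exact_mod_cast Real.pi_ne_zero
  have h2 : z * Complex.I = k := by
    apply mul_left_cancel₀ hpi
    linear_combination hk
  have h3 : z = -(k : ℂ) * Complex.I := by
    linear_combination (-Complex.I) * h2 + z * Complex.I_mul_I
  have h4 : z.im = -(k : ℝ) := by rw [h3]; simp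
  rw [h4, abs_neg] at hz
  have h5 : k = 0 := by
    have h6 : |k| < 1 := by
      have : (|k| : ℝ) < 1 := by linarith
      exact_mod_cast this
    exact Int.abs_lt_one_iff.1 h6
  exact h0 (by rw [h3, h5]; simp)

theorem differentiableAt_contourFun (j : ℕ) {z : ℂ} (hz : |z.im| ≤ 1 / 2) (h0 : z ≠ 0) :
    DifferentiableAt ℂ (contourFun j) z := by
  have := sinh_pi_mul_ne_zero hz h0
  unfold contourFun
  refine DifferentiableAt.div ?_ ?_ (pow_ne_zero 2 this)
  · refine DifferentiableAt.mul (DifferentiableAt.mul (by fun_prop) ?_) (by fun_prop)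
    refine DifferentiableAt.fun_finsetProd fun k _ => by fun_prop
  · fun_prop

theorem continuousAt_contourFun_zero (j : ℕ) : ContinuousAt (contourFun j) 0 := by
  have hpi : (Real.pi : ℂ) ≠ 0 := by exact_mod_cast Real.pi_ne_zero
  have hs : Tendsto (fun z : ℂ => z⁻¹ * Complex.sinh (Real.pi * z)) (𝓝[≠] 0) (𝓝 Real.pi) := by
    have hl : HasDerivAt (fun z : ℂ => (Real.pi : ℂ) * z) Real.pi 0 := by
      simpa using (hasDerivAt_id (0 : ℂ)).const_mul (Real.pi : ℂ)
    have := hl.csinh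
    rw [hasDerivAt_iff_tendsto_slope] at this
    simpa [slope_fun_def] using this
  have hreg : Tendsto (fun z : ℂ => z * (∏ k ∈ Finset.Icc 1 j, ((k : ℂ) ^ 2 + z ^ 2))
      * Complex.cosh (Real.pi * z)) (𝓝[≠] 0) (𝓝 0) := by
    have : ContinuousAt (fun z : ℂ => z * (∏ k ∈ Finset.Icc 1 j, ((k : ℂ) ^ 2 + z ^ 2))
      * Complex.cosh (Real.pi * z)) 0 := by fun_prop
    simpa [ContinuousAt] using this.tendsto.mono_left nhdsWithin_le_nhds
  have h := hreg.mul ((hs.inv₀ hpi).pow 2)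
  rw [← continuousWithinAt_compl_self, ContinuousWithinAt]
  have h0 : contourFun j 0 = 0 := by simp [contourFun]
  rw [h0]
  rw [zero_mul] at h
  refine h.congr' ?_
  filter_upwards [self_mem_nhdsWithin] with z hz
  have hz : z ≠ 0 := hz
  unfold contourFun
  rw [mul_inv, inv_inv, div_eq_mul_inv]
  ring

theorem continuousAt_contourFun (j : ℕ) {z : ℂ} (hz : |z.im| ≤ 1 / 2) :
    ContinuousAt (contourFun j) z := by
  by_cases h0 : z = 0
  · rw [h0]; exact continuousAt_contourFun_zero j
  · exact (differentiableAt_contourFun j hz h0).continuousAt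

theorem contourFun_neg (j : ℕ) (z : ℂ) : contourFun j (-z) = -contourFun j z := by
  unfold contourFun
  rw [mul_neg, Complex.cosh_neg, Complex.sinh_neg, neg_sq, neg_sq]
  ring

/-- For `s = ± i` the factor `k ^ 2 + (x + s / 2) ^ 2` splits as
`(x + s (k + 1/2)) (x - s (k - 1/2))`, so that the shifted product telescopes against
`j! ^ 2 K_j(x) = ∏ (x + s (k - 1/2)) (x - s (k - 1/2))`. -/
theorem shifted_prod_eq (j : ℕ) (x : ℝ) {s : ℂ} (hs : s ^ 2 = -1) :
    (x + s / 2) * ∏ k ∈ Finset.Icc 1 j, ((k : ℂ) ^ 2 + (x + s / 2) ^ 2)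
      = (∏ k ∈ Finset.Icc 1 j, (k : ℂ) ^ 2) * ((polyK j).eval x : ℝ) * (x + s * (j + 1 / 2)) := by
  induction j with
  | zero => simp [polyK]; ring
  | succ j ih =>
    rw [Finset.prod_Icc_succ_top (by omega), Finset.prod_Icc_succ_top (by omega), ← mul_assoc, ih]
    have h : ((j : ℂ) + 1) ^ 2 * ((polyK (j + 1)).eval x : ℝ)
      = ((x : ℂ) ^ 2 + ((j : ℂ) + 1 / 2) ^ 2) * ((polyK j).eval x : ℝ) := by
      have := congrArg (fun y : ℝ => (y : ℂ)) (eval_polyK_succ j x)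
      push_cast at this
      exact this
    push_cast
    generalize (∏ k ∈ Finset.Icc 1 j, (k : ℂ) ^ 2) = c
    generalize (((polyK j).eval x : ℝ) : ℂ) = a at *
    generalize (((polyK (j + 1)).eval x : ℝ) : ℂ) = b at *
    linear_combination (-c * (x + s * (j + 1 + 1 / 2))) * h
      + c * a * (x * (3 / 4 + j) + s * (1 / 8 + j / 4)) * hs

theorem contourFun_shift (j : ℕ) (x : ℝ) {s : ℂ} (hs : s ^ 2 = -1)
    (hsinh : Complex.sinh (Real.pi * (s / 2)) = s) (hcosh : Complex.cosh (Real.pi * (s / 2)) = 0) :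
    contourFun j (x + s / 2)
      = -(s * (∏ k ∈ Finset.Icc 1 j, (k : ℂ) ^ 2) * ((polyK j).eval x : ℝ)
          * ((x + s * (j + 1 / 2)) * (x + s / 2) ^ 2)
          * (Complex.sinh (Real.pi * x) / Complex.cosh (Real.pi * x) ^ 2)) := by
  have h := shifted_prod_eq j x hs
  unfold contourFun
  rw [mul_add (Real.pi : ℂ), Complex.cosh_add, Complex.sinh_add, hsinh, hcosh]
  have h2 : (Complex.sinh (Real.pi * x) * 0 + Complex.cosh (Real.pi * x) * s) ^ 2
      = -Complex.cosh (Real.pi * x) ^ 2 := by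
    linear_combination Complex.cosh (Real.pi * x) ^ 2 * hs
  rw [h2, div_neg, mul_zero, zero_add, pow_succ, mul_assoc _ (x + s / 2) (∏ _ ∈ _, _), h]
  ring

theorem contourFun_lower_sub_upper (j : ℕ) (x : ℝ) :
    contourFun j (x + ((-(1 / 2) : ℝ) : ℂ) * Complex.I)
        - contourFun j (x + ((1 / 2 : ℝ) : ℂ) * Complex.I)
      = (∏ k ∈ Finset.Icc 1 j, (k : ℂ) ^ 2) * ((j + 1) ^ 2 / Real.pi) * Complex.I
        * ((((polyK (j + 1)).eval x - (polyK j).eval x) * weight x : ℝ) : ℂ) := by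
  have hsI : Complex.sinh (Real.pi * (Complex.I / 2)) = Complex.I := by
    rw [show (Real.pi : ℂ) * (Complex.I / 2) = (Real.pi / 2 : ℂ) * Complex.I by ring,
      Complex.sinh_mul_I, Complex.sin_pi_div_two, one_mul]
  have hcI : Complex.cosh (Real.pi * (Complex.I / 2)) = 0 := by
    rw [show (Real.pi : ℂ) * (Complex.I / 2) = (Real.pi / 2 : ℂ) * Complex.I by ring,
      Complex.cosh_mul_I, Complex.cos_pi_div_two]
  have hsI' : Complex.sinh (Real.pi * (-Complex.I / 2)) = -Complex.I := by
    rw [show (Real.pi : ℂ) * (-Complex.I / 2) = -(Real.pi * (Complex.I / 2)) by ring,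
      Complex.sinh_neg, hsI]
  have hcI' : Complex.cosh (Real.pi * (-Complex.I / 2)) = 0 := by
    rw [show (Real.pi : ℂ) * (-Complex.I / 2) = -(Real.pi * (Complex.I / 2)) by ring,
      Complex.cosh_neg, hcI]
  have e1 : ((-(1 / 2) : ℝ) : ℂ) * Complex.I = -Complex.I / 2 := by push_cast; ring
  have e2 : ((1 / 2 : ℝ) : ℂ) * Complex.I = Complex.I / 2 := by push_cast; ring
  rw [e1, e2, contourFun_shift j x (by simp) hsI hcI, contourFun_shift j x (by simp) hsI' hcI']
  have hK : ((j : ℝ) + 1) ^ 2 * ((polyK (j + 1)).eval x - (polyK j).eval x)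
      = (x ^ 2 - j - 3 / 4) * (polyK j).eval x := by
    linear_combination eval_polyK_succ j x
  have hK' : ((j : ℂ) + 1) ^ 2 * (((polyK (j + 1)).eval x : ℝ) - ((polyK j).eval x : ℝ))
      = ((x : ℂ) ^ 2 - j - 3 / 4) * ((polyK j).eval x : ℝ) := by
    have := congrArg (fun y : ℝ => (y : ℂ)) hK
    push_cast at this
    exact this
  have hpi : (Real.pi : ℂ) ≠ 0 := by exact_mod_cast Real.pi_ne_zero
  unfold weight
  push_cast
  generalize Complex.sinh (Real.pi * x) = S at *
  generalize (Complex.cosh (Real.pi * x)) = T at *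
  generalize (∏ k ∈ Finset.Icc 1 j, (k : ℂ) ^ 2) = c
  generalize (((polyK j).eval x : ℝ) : ℂ) = a at *
  generalize (((polyK (j + 1)).eval x : ℝ) : ℂ) = b at *
  have e3 : c * ((j + 1) ^ 2 / (Real.pi : ℂ)) * Complex.I
        * ((b - a) * (2 * Real.pi * x * S / T ^ 2))
      = c * Complex.I * (((j : ℂ) + 1) ^ 2 * (b - a)) * (2 * x) * (S / T ^ 2) := by
    field_simp
  rw [e3, hK']
  generalize S / T ^ 2 = V
  have hI : Complex.I ^ 2 = -1 := Complex.I_sq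
  linear_combination (c * a * x * Complex.I * V * (2 * j + 3 / 2)) * hI

/-- The left side of the rectangle does not contribute, since `contourFun` is odd. -/
theorem integral_contourFun_imaginary_axis (j : ℕ) :
    ∫ y in (-(1 / 2) : ℝ)..(1 / 2), contourFun j (y * Complex.I) = 0 := by
  have h := intervalIntegral.integral_comp_neg (a := -(1 / 2)) (b := 1 / 2)
    (fun y : ℝ => contourFun j (y * Complex.I))
  simp only [Complex.ofReal_neg, neg_mul, contourFun_neg, intervalIntegral.integral_neg,
    neg_neg] at h
  exact self_eq_neg.1 h.symm

theorem norm_contourFun_le (j : ℕ) {R y : ℝ} (hR : 1 ≤ R) (hy : |y| ≤ 1 / 2) :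
    ‖contourFun j (R + y * Complex.I)‖
      ≤ 16 * ((X ^ 3 * ∏ k ∈ Finset.Icc 1 j, (C ((k : ℝ) ^ 2) + X ^ 2) : ℝ[X]).eval (2 * R)
        / Real.exp (2 * R)) := by
  set z : ℂ := R + y * Complex.I with hz
  have hre : (Real.pi * z : ℂ).re = Real.pi * R := by simp [hz]
  have hzn : ‖z‖ ≤ 2 * R := by
    refine (norm_add_le _ _).trans ?_
    simp only [Complex.norm_real, norm_mul, Complex.norm_I, mul_one, Real.norm_eq_abs]
    rw [abs_of_nonneg (by linarith : (0 : ℝ) ≤ R)]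
    linarith
  have hpoly : ‖z ^ 3 * ∏ k ∈ Finset.Icc 1 j, ((k : ℂ) ^ 2 + z ^ 2)‖
      ≤ (X ^ 3 * ∏ k ∈ Finset.Icc 1 j, (C ((k : ℝ) ^ 2) + X ^ 2) : ℝ[X]).eval (2 * R) := by
    rw [norm_mul, norm_pow, norm_prod]
    simp only [eval_mul, eval_pow, eval_X, eval_prod, eval_add, eval_C]
    gcongr with k hk
    refine (norm_add_le _ _).trans ?_
    simp only [norm_pow, Complex.norm_natCast]
    gcongr
  have hcosh : ‖Complex.cosh (Real.pi * z)‖ ≤ Real.exp (Real.pi * R) := by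
    have h2 : ‖2 * Complex.cosh (Real.pi * z)‖ ≤ 2 * Real.exp (Real.pi * R) := by
      rw [Complex.two_cosh]
      refine (norm_add_le _ _).trans ?_
      rw [Complex.norm_exp, Complex.norm_exp, Complex.neg_re, hre]
      have : Real.exp (-(Real.pi * R)) ≤ Real.exp (Real.pi * R) :=
        Real.exp_le_exp.2 (by nlinarith [Real.pi_pos])
      linarith
    rw [norm_mul, Complex.norm_ofNat] at h2
    linarith
  have hsinh : Real.exp (Real.pi * R) / 4 ≤ ‖Complex.sinh (Real.pi * z)‖ := by
    have h2 : Real.exp (Real.pi * R) - Real.exp (-(Real.pi * R))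
        ≤ ‖2 * Complex.sinh (Real.pi * z)‖ := by
      rw [Complex.two_sinh]
      refine le_trans (le_of_eq ?_) (norm_sub_norm_le _ _)
      rw [Complex.norm_exp, Complex.norm_exp, Complex.neg_re, hre]
    rw [norm_mul, Complex.norm_ofNat] at h2
    have h3 : Real.exp (-(Real.pi * R)) ≤ 1 := Real.exp_le_one_iff.2 (by nlinarith [Real.pi_pos])
    have h4 : 2 ≤ Real.exp (Real.pi * R) := by
      nlinarith [Real.add_one_le_exp (Real.pi * R), Real.pi_gt_three]
    linarith
  unfold contourFun
  rw [norm_div, norm_mul, norm_pow]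
  calc _ ≤ (X ^ 3 * ∏ k ∈ Finset.Icc 1 j, (C ((k : ℝ) ^ 2) + X ^ 2) : ℝ[X]).eval (2 * R)
        * Real.exp (Real.pi * R) / (Real.exp (Real.pi * R) / 4) ^ 2 := by
        have := (norm_nonneg _).trans hpoly
        gcongr
    _ = 16 * ((X ^ 3 * ∏ k ∈ Finset.Icc 1 j, (C ((k : ℝ) ^ 2) + X ^ 2) : ℝ[X]).eval (2 * R)
        / Real.exp (Real.pi * R)) := by
        field_simp
        norm_num
    _ ≤ _ := by
        have := (norm_nonneg _).trans hpoly
        gcongr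
        nlinarith [Real.pi_gt_three]

theorem tendsto_integral_contourFun_right (j : ℕ) :
    Tendsto (fun R : ℝ => ∫ y in (-(1 / 2) : ℝ)..(1 / 2), contourFun j (R + y * Complex.I))
      atTop (𝓝 0) := by
  have hlim := ((Polynomial.tendsto_div_exp_atTop
    (X ^ 3 * ∏ k ∈ Finset.Icc 1 j, (C ((k : ℝ) ^ 2) + X ^ 2))).comp
      (tendsto_id.const_mul_atTop (two_pos (α := ℝ)))).const_mul 16
  rw [mul_zero] at hlim
  refine squeeze_zero_norm' ?_ hlim
  filter_upwards [eventually_ge_atTop 1] with R hR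
  refine (intervalIntegral.norm_integral_le_of_norm_le_const
    (C := 16 * ((X ^ 3 * ∏ k ∈ Finset.Icc 1 j, (C ((k : ℝ) ^ 2) + X ^ 2) : ℝ[X]).eval (2 * R)
      / Real.exp (2 * R))) fun y hy => ?_).trans (le_of_eq ?_)
  · refine norm_contourFun_le j hR ?_
    rw [uIoc_of_le (by norm_num)] at hy
    exact abs_le.2 ⟨hy.1.le, hy.2⟩
  · norm_num

theorem integral_polyK_succ_sub (j : ℕ) :
    ∫ u in Ioi (0 : ℝ), ((polyK (j + 1)).eval u - (polyK j).eval u) * weight u = 0 := by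
  set g : ℝ → ℝ := fun u => ((polyK (j + 1)).eval u - (polyK j).eval u) * weight u with hg
  have hint : IntegrableOn g (Ioi 0) := by
    simpa [hg] using integrableOn_eval_mul_weight (polyK (j + 1) - polyK j)
  set c : ℂ := (∏ k ∈ Finset.Icc 1 j, (k : ℂ) ^ 2) * ((j + 1) ^ 2 / Real.pi) * Complex.I with hc
  have hc0 : c ≠ 0 := by
    have h1 : (∏ k ∈ Finset.Icc 1 j, (k : ℂ) ^ 2) ≠ 0 := Finset.prod_ne_zero_iff.2 fun k hk => by
      have : k ≠ 0 := by have := (Finset.mem_Icc.1 hk).1; omega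
      positivity
    have h2 : (j : ℂ) + 1 ≠ 0 := Nat.cast_add_one_ne_zero j
    have hpi : (Real.pi : ℂ) ≠ 0 := by exact_mod_cast Real.pi_ne_zero
    exact mul_ne_zero (mul_ne_zero h1 (div_ne_zero (pow_ne_zero 2 h2) hpi)) Complex.I_ne_zero
  have hline : ∀ s : ℝ, |s| ≤ 1 / 2 →
      Continuous fun x : ℝ => contourFun j (x + (s : ℂ) * Complex.I) := by
    intro s hs
    refine continuous_iff_continuousAt.2 fun x => ?_
    exact ContinuousAt.comp (f := fun x : ℝ => (x : ℂ) + (s : ℂ) * Complex.I)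
      (continuousAt_contourFun j (by simpa using hs)) (by fun_prop)
  have hrect : ∀ R : ℝ, 0 ≤ R → c * ((∫ u in (0 : ℝ)..R, g u : ℝ) : ℂ)
      = -(Complex.I * ∫ y in (-(1 / 2) : ℝ)..(1 / 2), contourFun j (R + y * Complex.I)) := by
    intro R hR
    have h := Complex.integral_boundary_rect_eq_zero_of_continuousOn_of_differentiableOn
      (contourFun j) (⟨0, -(1 / 2)⟩ : ℂ) (⟨R, 1 / 2⟩ : ℂ) ?_ ?_
    · simp only [smul_eq_mul, Complex.ofReal_zero, zero_add] at h
      rw [integral_contourFun_imaginary_axis, mul_zero, sub_zero,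
        ← intervalIntegral.integral_sub
          ((hline _ (by norm_num [abs_le])).intervalIntegrable _ _)
          ((hline _ (by norm_num [abs_le])).intervalIntegrable _ _)] at h
      simp only [contourFun_lower_sub_upper] at h
      rw [intervalIntegral.integral_const_mul, ← hc, intervalIntegral.integral_ofReal] at h
      exact eq_neg_of_add_eq_zero_left h
    · intro w hw
      refine (continuousAt_contourFun j ?_).continuousWithinAt
      have := hw.2
      simp only [mem_preimage, uIcc_of_le (show (-(1 / 2) : ℝ) ≤ 1 / 2 by norm_num)] at this
      exact abs_le.2 this
    · intro w hw
      have h1 := hw.1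
      have h2 := hw.2
      simp only [mem_preimage, mem_Ioo, min_eq_left hR,
        min_eq_left (show (-(1 / 2) : ℝ) ≤ 1 / 2 by norm_num),
        max_eq_right (show (-(1 / 2) : ℝ) ≤ 1 / 2 by norm_num)] at h1 h2
      refine (differentiableAt_contourFun j (abs_le.2 ⟨h2.1.le, h2.2.le⟩) ?_).differentiableWithinAt
      rintro rfl
      simp at h1
  have h1 : Tendsto (fun R : ℝ => c * ((∫ u in (0 : ℝ)..R, g u : ℝ) : ℂ)) atTop
      (𝓝 (c * ((∫ u in Ioi (0 : ℝ), g u : ℝ) : ℂ))) :=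
    ((Complex.continuous_ofReal.tendsto _).comp
      (intervalIntegral_tendsto_integral_Ioi 0 hint tendsto_id)).const_mul c
  have h2 : Tendsto (fun R : ℝ => c * ((∫ u in (0 : ℝ)..R, g u : ℝ) : ℂ)) atTop (𝓝 0) := by
    have := ((tendsto_integral_contourFun_right j).const_mul Complex.I).neg
    rw [mul_zero, neg_zero] at this
    refine this.congr' ?_
    filter_upwards [eventually_ge_atTop 0] with R hR
    exact (hrect R hR).symm
  have h3 := tendsto_nhds_unique h1 h2
  simpa [hc0] using h3

theorem integral_polyK_mul_weight (j : ℕ) :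
    ∫ u in Ioi (0 : ℝ), (polyK j).eval u * weight u = 1 := by
  induction j with
  | zero => simpa [polyK] using integral_weight
  | succ j ih =>
    have h := integral_polyK_succ_sub j
    simp only [sub_mul] at h
    rw [integral_sub (integrableOn_eval_mul_weight _) (integrableOn_eval_mul_weight _), ih] at h
    linarith

/-! ### Orthonormality -/

theorem integral_polyP_mul_weight (n : ℕ) :
    ∫ u in Ioi (0 : ℝ), (polyP n).eval u * weight u = if n = 0 then 1 else 0 := by
  simp only [eval_polyP, Finset.sum_mul]
  rw [integral_finsetSum]
  · simp only [mul_assoc, integral_const_mul, integral_polyK_mul_weight, mul_one]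
    have h := @Int.alternating_sum_range_choose n
    have h2 := congrArg (fun m : ℤ => (m : ℝ)) h
    push_cast at h2
    rw [← h2]
    exact Finset.sum_congr rfl fun j _ => mul_comm _ _
  · intro j _
    simpa only [mul_assoc] using (integrableOn_eval_mul_weight (polyK j)).const_mul
      ((n.choose j : ℝ) * (-1) ^ j)

theorem integrableOn_polyP_mul_polyP (n p : ℕ) :
    IntegrableOn (fun u => (polyP n).eval u * (polyP p).eval u * weight u) (Ioi 0) := by
  simpa using integrableOn_eval_mul_weight (polyP n * polyP p)

/-- The operator `(f, g, h) ↦ a (f - g) + b (h - g)`, of which the birth-death generator is an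
instance, commutes with integration. -/
theorem integral_birthDeath {f g h : ℝ → ℝ} (a b : ℝ) (hf : IntegrableOn f (Ioi 0))
    (hg : IntegrableOn g (Ioi 0)) (hh : IntegrableOn h (Ioi 0)) :
    a * ((∫ u in Ioi (0 : ℝ), f u) - ∫ u in Ioi (0 : ℝ), g u)
        + b * ((∫ u in Ioi (0 : ℝ), h u) - ∫ u in Ioi (0 : ℝ), g u)
      = ∫ u in Ioi (0 : ℝ), (a * (f u - g u) + b * (h u - g u)) := by
  have h1 : IntegrableOn (fun u => a * (f u - g u)) (Ioi 0) := (hf.sub hg).const_mul a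
  have h2 : IntegrableOn (fun u => b * (h u - g u)) (Ioi 0) := (hh.sub hg).const_mul b
  rw [integral_add h1 h2, integral_const_mul,
    integral_const_mul, integral_sub hf hg, integral_sub hh hg]

theorem orthonormal_polyP (n p : ℕ) :
    ∫ u in Ioi (0 : ℝ), (polyP n).eval u * (polyP p).eval u * weight u
      = if n = p then 1 else 0 := by
  set c : ℕ → ℕ → ℝ := fun n p =>
    ∫ u in Ioi (0 : ℝ), (polyP n).eval u * (polyP p).eval u * weight u with hc
  have hint := integrableOn_polyP_mul_polyP
  -- multiplication by `-(u ^ 2 + 1 / 4)` acts as the generator on either factor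
  have hsymm : ∀ n p : ℕ,
      ((n : ℝ) + 1) ^ 2 * (c (n + 1) p - c n p) + (n : ℝ) ^ 2 * (c (n - 1) p - c n p)
        = ((p : ℝ) + 1) ^ 2 * (c n (p + 1) - c n p) + (p : ℝ) ^ 2 * (c n (p - 1) - c n p) := by
    intro n p
    simp only [hc]
    rw [integral_birthDeath _ _ (hint _ _) (hint _ _) (hint _ _),
      integral_birthDeath _ _ (hint _ _) (hint _ _) (hint _ _)]
    refine integral_congr_ae (Eventually.of_forall fun u => ?_)
    simp only
    linear_combination ((polyP p).eval u * weight u) * generator_eval_polyP n u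
      - ((polyP n).eval u * weight u) * generator_eval_polyP p u
  suffices H : ∀ p n, c n p = if n = p then 1 else 0 from H p n
  intro p
  induction p using Nat.strong_induction_on with
  | _ p ih =>
    intro n
    rcases p with _ | p
    · simpa [hc, polyP_zero] using integral_polyP_mul_weight n
    · have h := hsymm n p
      have hp : ((p : ℝ) + 1) ^ 2 ≠ 0 := by positivity
      -- for `p = 0` the truncated index `p - 1` is harmless because of the factor `p ^ 2`
      have hlow : (p : ℝ) ^ 2 * c n (p - 1) = (p : ℝ) ^ 2 * if n = p - 1 then 1 else 0 := by
        rcases p with _ | p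
        · simp
        · rw [ih (p + 1 - 1) (by omega)]
      rw [mul_sub ((p : ℝ) ^ 2), hlow] at h
      simp only [ih p (by omega)] at h
      apply mul_left_cancel₀ hp
      -- the Kronecker delta solves the same symmetric equation
      have hcases : ((n : ℝ) + 1) ^ 2 * ((if n + 1 = p then 1 else 0) - (if n = p then 1 else 0))
          + (n : ℝ) ^ 2 * ((if n - 1 = p then 1 else 0) - (if n = p then 1 else 0))
          = ((p : ℝ) + 1) ^ 2 * ((if n = p + 1 then 1 else 0) - (if n = p then 1 else 0))
          + ((p : ℝ) ^ 2 * (if n = p - 1 then 1 else 0)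
            - (p : ℝ) ^ 2 * if n = p then 1 else 0) := by
        by_cases h1 : n = p + 1
        · subst h1
          simp [show p + 1 ≠ p - 1 by omega, show p + 1 + 1 ≠ p by omega]
        by_cases h2 : n + 1 = p
        · subst h2
          simp [h1, show n - 1 ≠ n + 1 by omega]
        by_cases h3 : n = p
        · subst h3
          rcases n with _ | n <;> simp
        rcases n with _ | n
        · rcases p with _ | p
          · exact absurd rfl h3
          · simp [show ¬0 = p by omega, show ¬p = 0 by omega]
        · rcases p with _ | p
          · simp [show n ≠ 0 by omega]
          · simp [show n ≠ p + 1 by omega, show n + 1 ≠ p by omega, show n ≠ p by omega]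
      linear_combination hcases - h

/-! ### The spectral formula -/

theorem continuous_transitionIntegrand (ζ : ℝ) (n p : ℕ) :
    Continuous (transitionIntegrand ζ n p) := by
  have := continuous_weight
  unfold transitionIntegrand
  fun_prop

theorem abs_transitionIntegrand_le {ζ : ℝ} (hζ : 0 ≤ ζ) (n p : ℕ) (u : ℝ) :
    |transitionIntegrand ζ n p u| ≤ |(polyP n).eval u * (polyP p).eval u * weight u| := by
  unfold transitionIntegrand
  rw [mul_assoc, abs_mul, Real.abs_exp]
  refine mul_le_of_le_one_left (abs_nonneg _) (Real.exp_le_one_iff.2 ?_)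
  nlinarith [mul_nonneg (sq_nonneg u) hζ]

theorem integrableOn_transitionIntegrand {ζ : ℝ} (hζ : 0 ≤ ζ) (n p : ℕ) :
    IntegrableOn (transitionIntegrand ζ n p) (Ioi 0) :=
  Integrable.mono (integrableOn_polyP_mul_polyP n p)
    (continuous_transitionIntegrand ζ n p).aestronglyMeasurable
    (Eventually.of_forall fun u => abs_transitionIntegrand_le hζ n p u)

theorem transitionFormula_zero (n p : ℕ) :
    transitionFormula 0 n p = if n = p then 1 else 0 := by
  simp [transitionFormula, transitionIntegrand, orthonormal_polyP]

theorem abs_transitionFormula_le_one {ζ : ℝ} (hζ : 0 ≤ ζ) (n p : ℕ) :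
    |transitionFormula ζ n p| ≤ 1 := by
  have h1 : Real.exp (-ζ / 4) ≤ 1 := Real.exp_le_one_iff.2 (by linarith)
  have hn := integrableOn_polyP_mul_polyP n n
  have hp := integrableOn_polyP_mul_polyP p p
  have h2 : |∫ u in Ioi (0 : ℝ), transitionIntegrand ζ n p u|
      ≤ ∫ u in Ioi (0 : ℝ), ((1 / 2 : ℝ) * ((polyP n).eval u * (polyP n).eval u * weight u)
        + (1 / 2 : ℝ) * ((polyP p).eval u * (polyP p).eval u * weight u)) := by
    rw [← Real.norm_eq_abs]
    refine norm_integral_le_of_norm_le ((hn.const_mul (1 / 2)).add (hp.const_mul (1 / 2))) ?_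
    refine (ae_restrict_iff' measurableSet_Ioi).2 (Eventually.of_forall fun u hu => ?_)
    refine (abs_transitionIntegrand_le hζ n p u).trans ?_
    have hw := weight_nonneg (le_of_lt hu)
    rw [abs_mul, abs_of_nonneg hw, abs_mul]
    have h3 : |(polyP n).eval u| * |(polyP p).eval u|
        ≤ 1 / 2 * ((polyP n).eval u * (polyP n).eval u)
          + 1 / 2 * ((polyP p).eval u * (polyP p).eval u) := by
      nlinarith [sq_nonneg (|(polyP n).eval u| - |(polyP p).eval u|),
        abs_mul_abs_self ((polyP n).eval u), abs_mul_abs_self ((polyP p).eval u)]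
    nlinarith [mul_le_mul_of_nonneg_right h3 hw]
  rw [integral_add (hn.const_mul (1 / 2)) (hp.const_mul (1 / 2)), integral_const_mul,
    integral_const_mul, orthonormal_polyP, orthonormal_polyP] at h2
  rw [transitionFormula, abs_mul, Real.abs_exp]
  norm_num at h2
  exact mul_le_one₀ h1 (abs_nonneg _) h2

theorem continuousOn_transitionFormula (n p : ℕ) :
    ContinuousOn (fun ζ => transitionFormula ζ n p) (Ici 0) := by
  unfold transitionFormula
  refine ContinuousOn.mul (by fun_prop) ?_
  refine continuousOn_of_dominated
    (fun ζ _ => (continuous_transitionIntegrand ζ n p).aestronglyMeasurable)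
    (fun ζ hζ => Eventually.of_forall fun u => abs_transitionIntegrand_le hζ n p u)
    (integrableOn_polyP_mul_polyP n p).norm (Eventually.of_forall fun u => ?_)
  unfold transitionIntegrand
  fun_prop

/-- The spectral formula solves the backward equation of the chain with unit rate. -/
theorem hasDerivAt_transitionFormula {ζ : ℝ} (hζ : 0 < ζ) (n p : ℕ) :
    HasDerivAt (fun ζ => transitionFormula ζ n p)
      (((p : ℝ) + 1) ^ 2 * (transitionFormula ζ n (p + 1) - transitionFormula ζ n p)
        + (p : ℝ) ^ 2 * (transitionFormula ζ n (p - 1) - transitionFormula ζ n p)) ζ := by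
  have hbound : IntegrableOn
      (fun u => |u ^ 2 * ((polyP n).eval u * (polyP p).eval u * weight u)|) (Ioi 0) := by
    have h := integrableOn_eval_mul_weight (X ^ 2 * (polyP n * polyP p))
    simp only [eval_mul, eval_pow, eval_X, mul_assoc] at h
    simpa only [mul_assoc, IntegrableOn] using h.abs
  have hG := hasDerivAt_integral_of_dominated_loc_of_deriv_le
    (μ := volume.restrict (Ioi (0 : ℝ))) (F := fun ζ u => transitionIntegrand ζ n p u)
    (F' := fun ζ u => -u ^ 2 * transitionIntegrand ζ n p u)
    (bound := fun u => |u ^ 2 * ((polyP n).eval u * (polyP p).eval u * weight u)|)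
    (Ioi_mem_nhds hζ)
    (Eventually.of_forall fun ζ => (continuous_transitionIntegrand ζ n p).aestronglyMeasurable)
    (integrableOn_transitionIntegrand hζ.le n p)
    (((by fun_prop : Continuous fun u : ℝ => -u ^ 2).mul
      (continuous_transitionIntegrand ζ n p)).aestronglyMeasurable)
    (Eventually.of_forall fun u ξ hξ => by
      rw [Real.norm_eq_abs, abs_mul, abs_mul, abs_neg]
      exact mul_le_mul_of_nonneg_left (abs_transitionIntegrand_le (le_of_lt hξ) n p u)
        (abs_nonneg _))
    hbound
    (Eventually.of_forall fun u ξ _ => by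
      unfold transitionIntegrand
      have h1 : HasDerivAt (fun ξ : ℝ => -u ^ 2 * ξ) (-u ^ 2) ξ := by
        simpa using (hasDerivAt_id ξ).const_mul (-u ^ 2)
      refine ((h1.exp.mul_const _).mul_const _).congr_deriv ?_
      ring)
  have hE : HasDerivAt (fun ζ : ℝ => Real.exp (-ζ / 4)) (Real.exp (-ζ / 4) * (-1 / 4)) ζ :=
    ((hasDerivAt_id ζ).neg.div_const 4).exp
  refine (hE.mul hG.2).congr_deriv ?_
  have hi := fun q => integrableOn_transitionIntegrand hζ.le n q
  have hgen := integral_birthDeath (((p : ℝ) + 1) ^ 2) ((p : ℝ) ^ 2) (hi (p + 1)) (hi p)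
    (hi (p - 1))
  have heq : ∀ u, ((p : ℝ) + 1) ^ 2
        * (transitionIntegrand ζ n (p + 1) u - transitionIntegrand ζ n p u)
      + (p : ℝ) ^ 2 * (transitionIntegrand ζ n (p - 1) u - transitionIntegrand ζ n p u)
      = -u ^ 2 * transitionIntegrand ζ n p u + (-1 / 4) * transitionIntegrand ζ n p u := by
    intro u
    unfold transitionIntegrand
    linear_combination (Real.exp (-u ^ 2 * ζ) * (polyP n).eval u * weight u)
      * generator_eval_polyP p u
  simp only [heq] at hgen
  rw [integral_add hG.1 ((hi p).const_mul _), integral_const_mul] at hgen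
  unfold transitionFormula
  linear_combination (-Real.exp (-ζ / 4)) * hgen

/-! ### The backward equation: maximum principle and small-time limits -/

/-- Maximum principle for the backward equation of the birth-death chain with birth rates
`r (p+1)²` and death rates `r p²`: the function `p + 1` grows under the generator at most at the
exponential rate `2 r`, so that a subsolution bounded above cannot gain mass from infinity. -/
theorem nonpos_of_backward_equation {r a M : ℝ} (hr : 0 ≤ r) (D : ℝ → ℕ → ℝ)
    (hM : ∀ τ ∈ Icc 0 a, ∀ p, D τ p ≤ M)
    (hc : ∀ p, ContinuousOn (fun τ => D τ p) (Icc 0 a)) (h0 : ∀ p, D 0 p ≤ 0)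
    (hd : ∀ τ ∈ Ioc 0 a, ∀ p, HasDerivWithinAt (fun τ => D τ p)
      (r * (((p : ℝ) + 1) ^ 2 * (D τ (p + 1) - D τ p) + (p : ℝ) ^ 2 * (D τ (p - 1) - D τ p)))
      (Iic τ) τ) :
    ∀ τ ∈ Icc 0 a, ∀ p, D τ p ≤ 0 := by
  by_contra! hcon
  obtain ⟨τ₀, hτ₀, p₀, hpos⟩ := hcon
  -- `E` is positive at `(τ₀, p₀)` and negative for large `p`, so it has a positive global maximum;
  -- the rate `c` exceeds the growth rate `2 r` of `p + 1`
  set c : ℝ := 2 * r + 1 with hcdef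
  set ε : ℝ := Real.exp (-c * τ₀) * D τ₀ p₀ / (2 * ((p₀ : ℝ) + 1)) with hε
  have hε0 : 0 < ε := by positivity
  set E : ℝ → ℕ → ℝ := fun τ p => Real.exp (-c * τ) * D τ p - ε * ((p : ℝ) + 1) with hE
  have hE0 : 0 < E τ₀ p₀ := by
    have : E τ₀ p₀ = Real.exp (-c * τ₀) * D τ₀ p₀ / 2 := by
      simp only [hE, hε]
      field_simp
      ring
    rw [this]
    positivity
  have hM0 : 0 ≤ M := hpos.le.trans (hM τ₀ hτ₀ p₀)
  obtain ⟨K, hK⟩ := exists_nat_ge (M / ε)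
  rw [div_le_iff₀ hε0] at hK
  have hfar : ∀ τ ∈ Icc 0 a, ∀ p, K ≤ p → E τ p < 0 := by
    intro τ hτ p hp
    have h1 : Real.exp (-c * τ) ≤ 1 := Real.exp_le_one_iff.2 (by nlinarith [hτ.1])
    have h2 : Real.exp (-c * τ) * D τ p ≤ M := by
      calc _ ≤ Real.exp (-c * τ) * M :=
            mul_le_mul_of_nonneg_left (hM τ hτ p) (Real.exp_pos _).le
        _ ≤ 1 * M := mul_le_mul_of_nonneg_right h1 hM0
        _ = M := one_mul M
    have h3 : (K : ℝ) ≤ p := by exact_mod_cast hp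
    have h4 : (K : ℝ) * ε ≤ p * ε := mul_le_mul_of_nonneg_right h3 hε0.le
    simp only [hE]
    linarith
  have hmax : ∀ p, ∃ t ∈ Icc 0 a, IsMaxOn (fun τ => E τ p) (Icc 0 a) t := fun p =>
    isCompact_Icc.exists_isMaxOn ⟨τ₀, hτ₀⟩
      (((by fun_prop : Continuous fun τ : ℝ => Real.exp (-c * τ)).continuousOn.mul (hc p)).sub
        continuousOn_const)
  choose t ht htmax using hmax
  have hp₀K : p₀ ∈ Finset.range K := by
    by_contra h
    exact absurd (hfar τ₀ hτ₀ p₀ (by simpa using h)) hE0.not_gt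
  obtain ⟨q, -, hq⟩ := Finset.exists_max_image (Finset.range K) (fun p => E (t p) p) ⟨p₀, hp₀K⟩
  have hEq : 0 < E (t q) q := hE0.trans_le ((htmax p₀ hτ₀).trans (hq p₀ hp₀K))
  have hglob : ∀ τ ∈ Icc 0 a, ∀ p, E τ p ≤ E (t q) q := by
    intro τ hτ p
    by_cases hp : p < K
    · exact (htmax p hτ).trans (hq p (by simpa using hp))
    · exact ((hfar τ hτ p (by omega)).trans hEq).le
  set s := t q with hs
  have hs0 : 0 < s := by
    refine lt_of_le_of_ne (ht q).1 fun h => ?_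
    rw [← h] at hEq
    simp only [hE, mul_zero, Real.exp_zero, one_mul] at hEq
    have : 0 < ε * ((q : ℝ) + 1) := by positivity
    linarith [h0 q]
  -- the left derivative at the maximum is nonnegative
  have hexp : HasDerivAt (fun τ : ℝ => Real.exp (-c * τ)) (Real.exp (-c * s) * -c) s := by
    have h1 : HasDerivAt (fun τ : ℝ => -c * τ) (-c) s := by
      simpa using (hasDerivAt_id s).const_mul (-c)
    exact h1.exp
  have hder := ((hexp.hasDerivWithinAt (s := Iic s)).mul (hd s ⟨hs0, (ht q).2⟩ q)).sub_const
    (ε * ((q : ℝ) + 1))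
  have hder' := (hasDerivWithinAt_iff_tendsto_slope' (by simp)).1 (hder.mono Iio_subset_Iic_self)
  have hnonneg := ge_of_tendsto (b := 0) hder' (by
    filter_upwards [Ioo_mem_nhdsLT hs0] with y hy
    rw [slope_def_field]
    refine div_nonneg_of_nonpos ?_ (by linarith [hy.2])
    exact sub_nonpos.2 (hglob y ⟨hy.1.le, hy.2.le.trans (ht q).2⟩ q))
  have hup := hglob s (ht q) (q + 1)
  have hdown := hglob s (ht q) (q - 1)
  simp only [hE] at hup hdown hEq
  set e := Real.exp (-c * s)
  have h1 : ((q : ℝ) + 1) ^ 2 * (e * D s (q + 1) - e * D s q) ≤ ((q : ℝ) + 1) ^ 2 * ε := by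
    refine mul_le_mul_of_nonneg_left ?_ (sq_nonneg _)
    push_cast at hup
    linarith
  have h2 : (q : ℝ) ^ 2 * (e * D s (q - 1) - e * D s q) ≤ (q : ℝ) ^ 2 * -ε := by
    rcases q with _ | q
    · simp
    · refine mul_le_mul_of_nonneg_left ?_ (sq_nonneg _)
      simp only [Nat.add_sub_cancel] at hdown ⊢
      push_cast at hdown
      linarith
  have h3 : r * (((q : ℝ) + 1) ^ 2 * (e * D s (q + 1) - e * D s q)
      + (q : ℝ) ^ 2 * (e * D s (q - 1) - e * D s q)) ≤ r * ((2 * q + 1) * ε) := by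
    refine mul_le_mul_of_nonneg_left ?_ hr
    linarith
  have h4 : 0 < c * (e * D s q - ε * ((q : ℝ) + 1)) := mul_pos (by positivity) hEq
  have h5 : 0 < ε * ((q : ℝ) + 1) := by positivity
  have h6 : 0 ≤ r * ε := by positivity
  nlinarith

theorem integrable_nat_of_abs_le {μ : Measure ℕ} [IsFiniteMeasure μ] {f : ℕ → ℝ} {c : ℝ}
    (hf : ∀ j, |f j| ≤ c) : Integrable f μ :=
  Integrable.of_bound (measurable_of_countable f).aestronglyMeasurable c
    (Eventually.of_forall hf)

theorem abs_integral_sub_le {μ : Measure ℕ} [IsProbabilityMeasure μ] {f : ℕ → ℝ} {c : ℝ}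
    (hf : ∀ j, |f j| ≤ c) (i : ℕ) :
    |(∫ j, f j ∂μ) - f i| ≤ 2 * c * (1 - ∫ j, (if j ∈ ({i} : Finset ℕ) then 1 else 0 : ℝ) ∂μ) := by
  have hI : Integrable (fun j => (if j ∈ ({i} : Finset ℕ) then 1 else 0 : ℝ)) μ :=
    integrable_nat_of_abs_le (c := 1) fun j => by split_ifs <;> simp
  have h1 : (∫ j, f j ∂μ) - f i = ∫ j, (f j - f i) ∂μ := by
    rw [integral_sub (integrable_nat_of_abs_le hf) (integrable_const _)]
    simp
  have h2 : 2 * c * (1 - ∫ j, (if j ∈ ({i} : Finset ℕ) then 1 else 0 : ℝ) ∂μ)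
      = ∫ j, 2 * c * (1 - (if j ∈ ({i} : Finset ℕ) then 1 else 0 : ℝ)) ∂μ := by
    rw [integral_const_mul, integral_sub (integrable_const _) hI]
    simp
  rw [h1, h2, ← Real.norm_eq_abs]
  refine norm_integral_le_of_norm_le (((integrable_const _).sub hI).const_mul _)
    (Eventually.of_forall fun j => ?_)
  rw [Real.norm_eq_abs]
  by_cases hj : j = i
  · simp [hj]
  · have := abs_sub (f j) (f i)
    simp only [Finset.mem_singleton, hj, if_false]
    linarith [hf j, hf i]

/-- The generator as a small-time limit, extended from finitely supported functions to bounded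
functions, which may moreover vary with the time step. The row of the generator sums to zero on
`{i - 1, i, i + 1}`, so the mass outside these three states is negligible. -/
theorem tendsto_generator_of_bounded {r : ℝ} {μ : ℝ → Measure ℕ}
    (hμ : ∀ᶠ h in 𝓝[>] (0 : ℝ), IsProbabilityMeasure (μ h)) (i : ℕ)
    (hA : ∀ φ : ℕ → ℝ, φ.support.Finite →
      Tendsto (fun h : ℝ => ((∫ j, φ j ∂(μ h)) - φ i) / h) (𝓝[>] 0)
        (𝓝 (r * (((i : ℝ) + 1) ^ 2 * (φ (i + 1) - φ i) + (i : ℝ) ^ 2 * (φ (i - 1) - φ i)))))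
    {ψ : ℝ → ℕ → ℝ} {φ : ℕ → ℝ} (hψ : ∀ᶠ h in 𝓝[>] (0 : ℝ), ∀ j, |ψ h j| ≤ 1)
    (hφ : ∀ j, |φ j| ≤ 1) (hlim : ∀ j, Tendsto (fun h => ψ h j) (𝓝[>] 0) (𝓝 (φ j))) :
    Tendsto (fun h : ℝ => ((∫ j, ψ h j ∂(μ h)) - ψ h i) / h) (𝓝[>] 0)
      (𝓝 (r * (((i : ℝ) + 1) ^ 2 * (φ (i + 1) - φ i) + (i : ℝ) ^ 2 * (φ (i - 1) - φ i)))) := by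
  set S : Finset ℕ := {i - 1, i, i + 1} with hS
  have hfin : ∀ (F : Finset ℕ) (f : ℕ → ℝ),
      (Function.support fun k => if k ∈ F then f k else 0).Finite := fun F f =>
    F.finite_toSet.subset fun k hk => by
      by_contra h
      have h : k ∉ F := h
      simp [h] at hk
  have h1 := hA _ (hfin S φ)
  have h2 := hA _ (hfin S fun _ => 1)
  have h3 := hA _ (hfin {i} fun _ => 1)
  have m1 : i - 1 ∈ S := by simp [hS]
  have m2 : i ∈ S := by simp [hS]
  have m3 : i + 1 ∈ S := by simp [hS]
  simp only [m1, m2, m3, if_true] at h1 h2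
  simp only [Finset.mem_singleton_self, if_true] at h3
  -- oscillation of `ψ h - 1_S φ` over `S`
  set δ : ℝ → ℝ := fun h => ∑ k ∈ S, |(ψ h k - φ k) - (ψ h i - φ i)| with hδ
  have hδ0 : Tendsto δ (𝓝[>] 0) (𝓝 0) := by
    have : Tendsto δ (𝓝[>] 0) (𝓝 (∑ k ∈ S, |(φ k - φ k) - (φ i - φ i)|)) :=
      tendsto_finsetSum _ fun k _ =>
        ((((hlim k).sub_const _).sub ((hlim i).sub_const _))).abs
    simpa using this
  have hbound := (hδ0.mul h3.neg).add (h2.neg.const_mul 4)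
  simp only [sub_self, mul_zero, add_zero, zero_mul, neg_zero] at hbound
  have hrest : Tendsto (fun h : ℝ => ((∫ j, (ψ h j - if j ∈ S then φ j else 0) ∂(μ h))
      - (ψ h i - φ i)) / h) (𝓝[>] 0) (𝓝 0) := by
    refine squeeze_zero_norm' ?_ hbound
    filter_upwards [hμ, hψ, self_mem_nhdsWithin] with h hμh hψh hh
    have hh : 0 < h := hh
    have hI : ∀ F : Finset ℕ, Integrable (fun j => (if j ∈ F then 1 else 0 : ℝ)) (μ h) := fun F =>
      integrable_nat_of_abs_le (c := 1) fun j => by split_ifs <;> simp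
    have hI' : ∀ (F : Finset ℕ) (c : ℝ),
        Integrable (fun j => c * (1 - (if j ∈ F then 1 else 0 : ℝ))) (μ h) := fun F c =>
      ((integrable_const _).sub (hI F)).const_mul c
    have hχ : Integrable (fun j => ψ h j - if j ∈ S then φ j else 0) (μ h) :=
      (integrable_nat_of_abs_le hψh).sub
        (integrable_nat_of_abs_le (c := 1) fun j => by split_ifs <;> simp [hφ])
    have e1 : (∫ j, (ψ h j - if j ∈ S then φ j else 0) ∂(μ h)) - (ψ h i - φ i)
        = ∫ j, ((ψ h j - if j ∈ S then φ j else 0) - (ψ h i - φ i)) ∂(μ h) := by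
      rw [integral_sub hχ (integrable_const _)]
      simp
    have e2 : δ h * (1 - ∫ j, (if j ∈ ({i} : Finset ℕ) then 1 else 0 : ℝ) ∂(μ h))
          + 4 * (1 - ∫ j, (if j ∈ S then 1 else 0 : ℝ) ∂(μ h))
        = ∫ j, (δ h * (1 - (if j ∈ ({i} : Finset ℕ) then 1 else 0 : ℝ))
          + 4 * (1 - (if j ∈ S then 1 else 0 : ℝ))) ∂(μ h) := by
      rw [integral_add (hI' _ _) (hI' _ _), integral_const_mul, integral_const_mul,
        integral_sub (integrable_const _) (hI _), integral_sub (integrable_const _) (hI _)]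
      simp
    have hδh : 0 ≤ δ h := Finset.sum_nonneg fun _ _ => abs_nonneg _
    have e3 : |(∫ j, (ψ h j - if j ∈ S then φ j else 0) ∂(μ h)) - (ψ h i - φ i)|
        ≤ δ h * (1 - ∫ j, (if j ∈ ({i} : Finset ℕ) then 1 else 0 : ℝ) ∂(μ h))
          + 4 * (1 - ∫ j, (if j ∈ S then 1 else 0 : ℝ) ∂(μ h)) := by
      rw [e1, e2, ← Real.norm_eq_abs]
      refine norm_integral_le_of_norm_le ((hI' _ _).add (hI' _ _))
        (Eventually.of_forall fun j => ?_)
      rw [Real.norm_eq_abs]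
      by_cases hj : j ∈ S
      · by_cases hji : j = i
        · subst hji
          simp [hj]
        · have := Finset.single_le_sum (f := fun k => |(ψ h k - φ k) - (ψ h i - φ i)|)
            (fun _ _ => abs_nonneg _) hj
          simpa [hj, hji] using this
      · have hji : j ≠ i := fun h => hj (h ▸ m2)
        simp only [hj, if_false, Finset.mem_singleton, hji]
        have a1 := abs_sub (ψ h j - 0) (ψ h i - φ i)
        have a2 := abs_sub (ψ h i) (φ i)
        rw [sub_zero] at a1 ⊢
        linarith [hψh j, hψh i, hφ i]
    rw [norm_div, Real.norm_eq_abs, Real.norm_eq_abs, abs_of_pos hh, div_le_iff₀ hh]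
    refine e3.trans (le_of_eq ?_)
    field_simp
    ring
  have hsum := h1.add hrest
  rw [add_zero] at hsum
  refine hsum.congr' ?_
  filter_upwards [hμ, hψ] with h hμh hψh
  rw [← add_div, integral_sub (integrable_nat_of_abs_le hψh)
    (integrable_nat_of_abs_le (c := 1) fun j => by split_ifs <;> simp [hφ])]
  ring

/-! ### Transition families with the given generator -/

theorem scatteringRate_nonneg {c₀ γ ω κ : ℝ} (hγ : 0 ≤ γ) : 0 ≤ scatteringRate c₀ γ ω κ := by
  unfold scatteringRate
  positivity

section Transition

variable {ℓ : ℝ} {T : ℝ → ℝ → Kernel ℕ ℕ}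

theorem IsTransitionFamily.real_eq_integral (hT : IsTransitionFamily ℓ T) {s t u : ℝ}
    (hs : 0 ≤ s) (hst : s ≤ t) (htu : t ≤ u) (hu : u ≤ ℓ) (p n : ℕ) :
    (T s u p).real {n} = ∫ j, (T t u j).real {n} ∂(T s t p) := by
  have := hT.markov t u (hs.trans hst) htu hu
  rw [← hT.chapman_kolmogorov s t u hs hst htu hu, measureReal_def,
    Kernel.comp_apply' _ _ _ (measurableSet_singleton n)]
  simp only [measureReal_def]
  rw [integral_toReal (measurable_of_countable _).aemeasurable
    (Eventually.of_forall fun j => measure_lt_top _ _)]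

theorem IsTransitionFamily.abs_real_le_one (hT : IsTransitionFamily ℓ T) {s t : ℝ}
    (hs : 0 ≤ s) (hst : s ≤ t) (ht : t ≤ ℓ) (p n : ℕ) : |(T s t p).real {n}| ≤ 1 := by
  have := hT.markov s t hs hst ht
  rw [abs_of_nonneg measureReal_nonneg]
  exact measureReal_le_one

theorem IsTransitionFamily.real_refl (hT : IsTransitionFamily ℓ T) {s : ℝ} (hs : 0 ≤ s)
    (hsℓ : s ≤ ℓ) (p n : ℕ) : (T s s p).real {n} = if n = p then 1 else 0 := by
  rw [hT.refl s hs hsℓ, Kernel.id_apply, measureReal_def,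
    Measure.dirac_apply' _ (measurableSet_singleton n)]
  by_cases h : n = p
  · simp [h]
  · simp [h, Ne.symm h]

/-- The chain stays at `i` over short times with probability close to `1`. The quantity is the bound
of `abs_integral_sub_le` for functions bounded by `1`. -/
theorem tendsto_one_sub_stay {A : (ℕ → ℝ) → ℕ → ℝ} {μ : ℝ → Measure ℕ} {i : ℕ}
    (hA : ∀ φ : ℕ → ℝ, φ.support.Finite →
      Tendsto (fun h : ℝ => ((∫ j, φ j ∂(μ h)) - φ i) / h) (𝓝[>] 0) (𝓝 (A φ i))) :
    Tendsto (fun h => 2 * 1 * (1 - ∫ j, (if j ∈ ({i} : Finset ℕ) then 1 else 0 : ℝ) ∂(μ h)))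
      (𝓝[>] 0) (𝓝 0) := by
  have h1 := hA (fun j => if j ∈ ({i} : Finset ℕ) then 1 else 0)
    ((finite_singleton i).subset fun j hj => by
      by_contra h
      have h : j ≠ i := h
      simp [h] at hj)
  have hid : Tendsto (fun h : ℝ => h) (𝓝[>] 0) (𝓝 0) :=
    tendsto_nhdsWithin_of_tendsto_nhds tendsto_id
  have h2 := (h1.mul hid).const_mul (-2)
  rw [mul_zero, mul_zero] at h2
  refine h2.congr' ?_
  filter_upwards [self_mem_nhdsWithin] with h hh
  have hh : h ≠ 0 := ne_of_gt hh
  simp only [Finset.mem_singleton_self, if_true]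
  field_simp
  ring

theorem eventually_add_le {s t : ℝ} (hst : s < t) : ∀ᶠ h in 𝓝[>] (0 : ℝ), 0 < h ∧ s + h ≤ t := by
  filter_upwards [Ioo_mem_nhdsGT (sub_pos.2 hst)] with h hh
  exact ⟨hh.1, by linarith [hh.2]⟩

theorem HasGenerator.tendsto_real_right {A : (ℕ → ℝ) → ℕ → ℝ} (hT : IsTransitionFamily ℓ T)
    (hG : HasGenerator ℓ T A) {s t : ℝ} (hs : 0 ≤ s) (hst : s < t) (ht : t ≤ ℓ) (p n : ℕ) :
    Tendsto (fun h => (T (s + h) t p).real {n}) (𝓝[>] 0) (𝓝 ((T s t p).real {n})) := by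
  refine tendsto_iff_norm_sub_tendsto_zero.2 (squeeze_zero' (Eventually.of_forall fun _ =>
    norm_nonneg _) ?_ (tendsto_one_sub_stay fun φ hφ => hG.right φ hφ p s hs (hst.trans_le ht)))
  filter_upwards [eventually_add_le hst] with h hh
  have := hT.markov s (s + h) hs (by linarith) (by linarith)
  rw [norm_sub_rev, hT.real_eq_integral hs (by linarith : s ≤ s + h) hh.2 ht]
  exact abs_integral_sub_le (fun j => hT.abs_real_le_one (by linarith) hh.2 ht j n) p

theorem HasGenerator.tendsto_real_left {A : (ℕ → ℝ) → ℕ → ℝ} (hT : IsTransitionFamily ℓ T)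
    (hG : HasGenerator ℓ T A) {s t : ℝ} (hs : 0 < s) (hst : s ≤ t) (ht : t ≤ ℓ) (p n : ℕ) :
    Tendsto (fun h => (T (s - h) t p).real {n}) (𝓝[>] 0) (𝓝 ((T s t p).real {n})) := by
  refine tendsto_iff_norm_sub_tendsto_zero.2 (squeeze_zero' (Eventually.of_forall fun _ =>
    norm_nonneg _) ?_ (tendsto_one_sub_stay fun φ hφ => hG.left φ hφ p s hs (hst.trans ht)))
  filter_upwards [eventually_add_le hs] with h hh
  have := hT.markov (s - h) s (by linarith) (by linarith) (by linarith)
  rw [hT.real_eq_integral (by linarith : 0 ≤ s - h) (by linarith : s - h ≤ s) hst ht]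
  exact abs_integral_sub_le (fun j => hT.abs_real_le_one hs.le hst ht j n) p

/-- The backward equation, as a right derivative in the starting point. -/
theorem HasGenerator.backward {c₀ γ ω κ : ℝ} (hT : IsTransitionFamily ℓ T)
    (hG : HasGenerator ℓ T (jumpGenerator c₀ γ ω κ)) {s t : ℝ} (hs : 0 ≤ s) (hst : s < t)
    (ht : t ≤ ℓ) (p n : ℕ) :
    Tendsto (fun h => ((T s t p).real {n} - (T (s + h) t p).real {n}) / h) (𝓝[>] 0)
      (𝓝 (jumpGenerator c₀ γ ω κ (fun j => (T s t j).real {n}) p)) := by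
  have h := tendsto_generator_of_bounded (r := scatteringRate c₀ γ ω κ)
    (μ := fun h => T s (s + h) p) (ψ := fun h j => (T (s + h) t j).real {n})
    (φ := fun j => (T s t j).real {n}) ?_ p
    (fun φ hφ => hG.right φ hφ p s hs (hst.trans_le ht)) ?_
    (fun j => hT.abs_real_le_one hs hst.le ht j n)
    (fun j => HasGenerator.tendsto_real_right hT hG hs hst ht j n)
  · refine h.congr' ?_
    filter_upwards [eventually_add_le hst] with h hh
    rw [hT.real_eq_integral hs (by linarith : s ≤ s + h) hh.2 ht]
  · filter_upwards [eventually_add_le hst] with h hh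
    have := hT.markov s (s + h) hs (by linarith) (by linarith)
    infer_instance
  · filter_upwards [eventually_add_le hst] with h hh j
    exact hT.abs_real_le_one (by linarith) hh.2 ht j n

theorem tendsto_const_sub_nhdsLT (τ : ℝ) : Tendsto (fun y => τ - y) (𝓝[<] τ) (𝓝[>] 0) := by
  refine tendsto_nhdsWithin_iff.2 ⟨?_, ?_⟩
  · have : Tendsto (fun y => τ - y) (𝓝 τ) (𝓝 (τ - τ)) :=
      (continuous_const.sub continuous_id).tendsto τ
    rw [sub_self] at this
    exact this.mono_left nhdsWithin_le_nhds
  · filter_upwards [self_mem_nhdsWithin] with y hy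
    exact mem_Ioi.2 (sub_pos.2 (mem_Iio.1 hy))

theorem tendsto_sub_const_nhdsGT (τ : ℝ) : Tendsto (fun y => y - τ) (𝓝[>] τ) (𝓝[>] 0) := by
  refine tendsto_nhdsWithin_iff.2 ⟨?_, ?_⟩
  · have : Tendsto (fun y => y - τ) (𝓝 τ) (𝓝 (τ - τ)) :=
      (continuous_id.sub continuous_const).tendsto τ
    rw [sub_self] at this
    exact this.mono_left nhdsWithin_le_nhds
  · filter_upwards [self_mem_nhdsWithin] with y hy
    exact mem_Ioi.2 (sub_pos.2 (mem_Ioi.1 hy))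

/-- The backward equation in the time `τ` to the end point `t`. -/
theorem HasGenerator.hasDerivWithinAt {c₀ γ ω κ : ℝ} (hT : IsTransitionFamily ℓ T)
    (hG : HasGenerator ℓ T (jumpGenerator c₀ γ ω κ)) {τ t : ℝ} (hτ : 0 < τ) (hτt : τ ≤ t)
    (ht : t ≤ ℓ) (p n : ℕ) :
    HasDerivWithinAt (fun τ => (T (t - τ) t p).real {n})
      (jumpGenerator c₀ γ ω κ (fun j => (T (t - τ) t j).real {n}) p) (Iic τ) τ := by
  rw [← hasDerivWithinAt_Iio_iff_Iic, hasDerivWithinAt_iff_tendsto_slope' (by simp)]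
  have h := (HasGenerator.backward hT hG (sub_nonneg.2 hτt) (by linarith : t - τ < t) ht p n).comp
    (tendsto_const_sub_nhdsLT τ)
  refine h.congr' (Eventually.of_forall fun y => ?_)
  simp only [Function.comp_apply]
  rw [slope_comm, slope_def_field, show t - τ + (τ - y) = t - y by ring]

theorem HasGenerator.continuousOn {c₀ γ ω κ : ℝ} (hT : IsTransitionFamily ℓ T)
    (hG : HasGenerator ℓ T (jumpGenerator c₀ γ ω κ)) {a t : ℝ} (hat : a ≤ t)
    (ht : t ≤ ℓ) (p n : ℕ) :
    ContinuousOn (fun τ => (T (t - τ) t p).real {n}) (Icc 0 a) := by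
  intro τ hτ
  have hleft : 0 < τ → ContinuousWithinAt (fun τ => (T (t - τ) t p).real {n}) (Iic τ) τ :=
    fun h => (HasGenerator.hasDerivWithinAt hT hG h (hτ.2.trans hat) ht p n).continuousWithinAt
  have hright : τ < a → ContinuousWithinAt (fun τ => (T (t - τ) t p).real {n}) (Ici τ) τ := by
    intro h
    rw [← continuousWithinAt_Ioi_iff_Ici]
    refine ((HasGenerator.tendsto_real_left hT hG (by linarith : 0 < t - τ)
      (by linarith [hτ.1]) ht p n).comp (tendsto_sub_const_nhdsGT τ)).congr' ?_
    refine Eventually.of_forall fun y => ?_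
    simp only [Function.comp_apply]
    rw [show t - τ - (y - τ) = t - y by ring]
  rcases hτ.1.eq_or_lt with h0 | h0
  · rcases hτ.2.eq_or_lt with ha | ha
    · rw [show Icc 0 a = {τ} by rw [← h0, ← ha, ← h0, Icc_self]]
      exact continuousWithinAt_singleton
    · exact (hright ha).mono fun y hy => h0 ▸ hy.1
  · rcases hτ.2.eq_or_lt with ha | ha
    · exact (hleft h0).mono fun y hy => ha ▸ hy.2
    · exact (continuousAt_iff_continuous_left_right.2 ⟨hleft h0, hright ha⟩).continuousWithinAt

theorem hasDerivAt_transitionFormula_mul {r τ : ℝ} (hr : 0 ≤ r) (hτ : 0 < τ) (n p : ℕ) :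
    HasDerivAt (fun τ => transitionFormula (r * τ) n p)
      (r * (((p : ℝ) + 1) ^ 2
          * (transitionFormula (r * τ) n (p + 1) - transitionFormula (r * τ) n p)
        + (p : ℝ) ^ 2
          * (transitionFormula (r * τ) n (p - 1) - transitionFormula (r * τ) n p))) τ := by
  -- for `r = 0` the formula is evaluated at time `0`, where it need not be differentiable
  rcases hr.eq_or_lt with rfl | hr
  · simpa using hasDerivAt_const τ (transitionFormula 0 n p)
  · have h1 : HasDerivAt (fun τ : ℝ => r * τ) r τ := by
      simpa using (hasDerivAt_id τ).const_mul r
    refine ((hasDerivAt_transitionFormula (mul_pos hr hτ) n p).comp τ h1).congr_deriv ?_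
    ring

/-- The transition function is the unique bounded solution of the backward equation. -/
theorem real_eq_transitionFormula {c₀ γ ω κ : ℝ} (hγ : 0 ≤ γ) (hT : IsTransitionFamily ℓ T)
    (hG : HasGenerator ℓ T (jumpGenerator c₀ γ ω κ)) {z₀ z : ℝ} (hz₀ : 0 ≤ z₀) (hz : 0 ≤ z)
    (hzℓ : z₀ + z ≤ ℓ) (n p : ℕ) :
    (T z₀ (z₀ + z) p).real {n} = transitionFormula (scatteringRate c₀ γ ω κ * z) n p := by
  set r := scatteringRate c₀ γ ω κ with hrdef
  have hr : 0 ≤ r := scatteringRate_nonneg hγ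
  set t := z₀ + z with ht
  set f : ℝ → ℕ → ℝ := fun τ p => (T (t - τ) t p).real {n} with hf
  set g : ℝ → ℕ → ℝ := fun τ p => transitionFormula (r * τ) n p with hg
  have hf1 : ∀ τ ∈ Icc 0 z, ∀ p, |f τ p| ≤ 1 := fun τ hτ p =>
    hT.abs_real_le_one (by linarith [hτ.2]) (by linarith [hτ.1]) hzℓ p n
  have hg1 : ∀ τ ∈ Icc 0 z, ∀ p, |g τ p| ≤ 1 := fun τ hτ p =>
    abs_transitionFormula_le_one (mul_nonneg hr hτ.1) n p
  have hfc : ∀ p, ContinuousOn (fun τ => f τ p) (Icc 0 z) := fun p =>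
    HasGenerator.continuousOn hT hG (by linarith) hzℓ p n
  have hgc : ∀ p, ContinuousOn (fun τ => g τ p) (Icc 0 z) := fun p =>
    (continuousOn_transitionFormula n p).comp (by fun_prop) fun τ hτ => mul_nonneg hr hτ.1
  have h0 : ∀ p, f 0 p = g 0 p := fun p => by
    simp only [hf, hg, sub_zero, mul_zero, transitionFormula_zero]
    exact hT.real_refl (by linarith) hzℓ p n
  have hfd := fun τ (hτ : τ ∈ Ioc 0 z) p =>
    HasGenerator.hasDerivWithinAt hT hG hτ.1 (by linarith [hτ.2] : τ ≤ t) hzℓ p n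
  have hgd := fun τ (hτ : τ ∈ Ioc 0 z) p =>
    (hasDerivAt_transitionFormula_mul hr hτ.1 n p).hasDerivWithinAt (s := Iic τ)
  have hle := nonpos_of_backward_equation hr (fun τ p => f τ p - g τ p) (a := z) (M := 2)
    (fun τ hτ p => by linarith [abs_le.1 (hf1 τ hτ p), abs_le.1 (hg1 τ hτ p)])
    (fun p => (hfc p).sub (hgc p)) (fun p => by simp [h0])
    (fun τ hτ p => ((hfd τ hτ p).sub (hgd τ hτ p)).congr_deriv (by
      simp only [jumpGenerator, hf, hg]; ring)) z ⟨hz, le_rfl⟩ p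
  have hge := nonpos_of_backward_equation hr (fun τ p => g τ p - f τ p) (a := z) (M := 2)
    (fun τ hτ p => by linarith [abs_le.1 (hf1 τ hτ p), abs_le.1 (hg1 τ hτ p)])
    (fun p => (hgc p).sub (hfc p)) (fun p => by simp [h0])
    (fun τ hτ p => ((hgd τ hτ p).sub (hfd τ hτ p)).congr_deriv (by
      simp only [jumpGenerator, hf, hg]; ring)) z ⟨hz, le_rfl⟩ p
  have heq : f z p = g z p := by linarith
  simpa [hf, hg, ht] using heq

end Transition

/-- Integrating the Markov property over the event `N s = p`. -/
theorem IsJumpMarkovProcess.cond_real {Ω : Type*} [MeasurableSpace Ω] {P : Measure Ω}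
    [IsProbabilityMeasure P] {ℓ : ℝ} {N : ℝ → Ω → ℕ} {T : ℝ → ℝ → Kernel ℕ ℕ}
    {A : (ℕ → ℝ) → ℕ → ℝ} (hN : IsJumpMarkovProcess P ℓ N T A) {s t : ℝ} (hs : 0 ≤ s)
    (hst : s ≤ t) (ht : t ≤ ℓ) (n p : ℕ) (hp : P (N s ⁻¹' {p}) ≠ 0) :
    (ProbabilityTheory.cond P (N s ⁻¹' {p})).real (N t ⁻¹' {n}) = (T s t p).real {n} := by
  have hms := hN.measurable s hs (hst.trans ht) (measurableSet_singleton p)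
  have hmt := hN.measurable t (hs.trans hst) ht (measurableSet_singleton n)
  have hle : pastSigma N s ≤ ‹MeasurableSpace Ω› := iSup₂_le fun u hu =>
    Measurable.comap_le (hN.measurable u hu.1 (hu.2.trans (hst.trans ht)))
  have hpast : MeasurableSet[pastSigma N s] (N s ⁻¹' {p}) :=
    le_iSup₂ (f := fun u (_ : u ∈ Icc (0 : ℝ) s) => MeasurableSpace.comap (N u) ⊤) s ⟨hs, le_rfl⟩
      _ ⟨{p}, trivial, rfl⟩
  have hint : Integrable ((N t ⁻¹' {n}).indicator fun _ => (1 : ℝ)) P :=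
    (integrable_const 1).indicator hmt
  have h1 := setIntegral_condExp hle hint hpast
  rw [setIntegral_congr_ae hms ((hN.markov_property s t hs hst ht n).mono fun x hx _ => hx)] at h1
  have h2 : ∫ x in N s ⁻¹' {p}, (T s t (N s x)).real {n} ∂P
      = ∫ _ in N s ⁻¹' {p}, (T s t p).real {n} ∂P :=
    setIntegral_congr_fun hms fun x hx => by
      have hx : N s x = p := hx
      simp only [hx]
  rw [h2, setIntegral_const, integral_indicator hmt, setIntegral_const, smul_eq_mul, smul_eq_mul,
    mul_one, measureReal_restrict_apply hmt] at h1
  have hp' : P.real (N s ⁻¹' {p}) ≠ 0 := by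
    rw [measureReal_def]
    exact ENNReal.toReal_ne_zero.2 ⟨hp, measure_ne_top _ _⟩
  rw [inter_comm] at h1
  rw [measureReal_def, cond_apply hms, ENNReal.toReal_mul, ENNReal.toReal_inv, ← measureReal_def,
    ← measureReal_def, ← h1, inv_mul_cancel_left₀ hp']

theorem proposition4p2 (c₀ γ ω κ : ℝ) (hc₀ : 0 < c₀) (hγ : 0 ≤ γ) (hκ₀ : 0 ≤ κ)
    (hκ : κ * c₀ < 1) :
    -- the transition probabilities of the transition family with the given generator
    (∀ (ℓ : ℝ) (T : ℝ → ℝ → Kernel ℕ ℕ), IsTransitionFamily ℓ T →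
      HasGenerator ℓ T (jumpGenerator c₀ γ ω κ) →
      ∀ (z₀ z : ℝ), 0 ≤ z₀ → 0 ≤ z → z₀ + z ≤ ℓ → ∀ n p : ℕ,
        (T z₀ (z₀ + z) p).real {n} =
          transitionFormula (scatteringRate c₀ γ ω κ * z) n p) ∧
    -- the conditional probabilities of the process
    (∀ (Ω : Type*) [MeasurableSpace Ω] (P : Measure Ω) [IsProbabilityMeasure P] (ℓ : ℝ)
      (N : ℝ → Ω → ℕ) (T : ℝ → ℝ → Kernel ℕ ℕ),
      IsJumpMarkovProcess P ℓ N T (jumpGenerator c₀ γ ω κ) →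
      ∀ (z₀ z : ℝ), 0 ≤ z₀ → 0 ≤ z → z₀ + z ≤ ℓ → ∀ n p : ℕ, P (N z₀ ⁻¹' {p}) ≠ 0 →
        (ProbabilityTheory.cond P (N z₀ ⁻¹' {p})).real (N (z₀ + z) ⁻¹' {n}) =
          transitionFormula (scatteringRate c₀ γ ω κ * z) n p) ∧
    -- the integrals in the formula converge absolutely
    (∀ z : ℝ, 0 ≤ z → ∀ n p : ℕ,
      IntegrableOn (transitionIntegrand (scatteringRate c₀ γ ω κ * z) n p) (Ioi 0)) ∧
    -- the explicit formula for the polynomials is equivalent to the recurrence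
    (∀ R : ℕ → ℝ[X],
      (∀ n, R n = polyP n) ↔
        (R 0 = 1 ∧ R 1 = C (3 / 4) - X ^ 2 ∧
          ∀ n : ℕ, 1 ≤ n →
            R (n + 1) =
              C (1 / ((n : ℝ) + 1) ^ 2) *
                  (C (2 * (n : ℝ) ^ 2 + 2 * (n : ℝ) + 3 / 4) - X ^ 2) * R n
                - C ((n : ℝ) ^ 2 / ((n : ℝ) + 1) ^ 2) * R (n - 1))) ∧
    -- orthonormality
    (∀ n p : ℕ,
      IntegrableOn (fun u => (polyP n).eval u * (polyP p).eval u * weight u) (Ioi 0) ∧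
      ∫ u in Ioi (0 : ℝ), (polyP n).eval u * (polyP p).eval u * weight u =
        if n = p then 1 else 0) := by
  exact ⟨fun _ _ hT hG _ _ hz₀ hz hzℓ n p => real_eq_transitionFormula hγ hT hG hz₀ hz hzℓ n p,
    fun _ _ _ _ _ _ _ hN _ _ hz₀ hz hzℓ n p hp =>
      (hN.cond_real hz₀ (le_add_of_nonneg_right hz) hzℓ n p hp).trans
        (real_eq_transitionFormula hγ hN.transition hN.generator hz₀ hz hzℓ n p),
    fun _ hz n p => integrableOn_transitionIntegrand (mul_nonneg (scatteringRate_nonneg hγ) hz) n p,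
    eq_polyP_iff_recurrence,
    fun n p => ⟨integrableOn_polyP_mul_polyP n p, orthonormal_polyP n p⟩⟩
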